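/- Let $d\ge 1$ be an integer. For integers $n_1,\dots,n_d\ge 0$ write $\mathcal G=\mathbb F_2^{n_1}\otimes\dots\otimes\mathbb F_2^{n_d}$, and for $I\subset\{1,\dots,d\}$ write $\mathbb F_2^I=\bigotimes_{i\in I}\mathbb F_2^{n_i}$ and $I^c=\{1,\dots,d\}\setminus I$, so that $\mathcal G=\mathbb F_2^I\otimes\mathbb F_2^{I^c}$ naturally. Let $\mathcal B$ be the multiset $\{u_1\otimes\dots\otimes u_d : u_i\in\mathbb F_2^{n_i}\text{ for all }i\}$, with one entry for every tuple $(u_1,\dots,u_d)$ (tuples with zero entries included). For a multiset $\mathcal B'$ of elements of $\mathcal G$ and $\eta\in\mathbb R$, a set $\mathcal A\subset\mathcal G$ is called $(\mathcal B',\eta)$-closed if the number of pairs $(a,b)$ with $a\in\mathcal A$, $b\in\mathcal B'$ (counted with multiplicity) and $a+b\in\mathcal A$ is at least $\eta|\mathcal A||\mathcal B'|$. A set $\mathcal D\subset\mathcal G$ is called $k$-simple if there are subspaces $H_I\subset\mathbb F_2^I$ of codimension at most $k$, one for each non-empty $I\subset\{1,\dots,d\}$, such that $\mathcal D$ is a translate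 of $\bigcap_{\emptyset\ne I\subset\{1,\dots,d\}}(H_I\otimes\mathbb F_2^{I^c})$. **Theorem.** For every $\theta>0$ there is $\epsilon=\epsilon(d,\theta)>0$, and for every $\delta>0$ there is a positive integer $k=k(d,\delta)$ (depending only on $d$ and $\delta$, not on $\theta$), with the following property. For all $n_1,\dots,n_d$, every submultiset $\mathcal B'\subset\mathcal B$ with $|\mathcal B'|\ge\delta|\mathcal B|$, and every non-empty set $\mathcal A\subset\mathcal G$ which is $(\mathcal B',1-\epsilon)$-closed, there exists a $k$-simple set $\mathcal D\subset\mathcal G$ such that $|\mathcal D\cap\mathcal A|\ge(1-\theta)|\mathcal D|$. -/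

import Mathlib

open scoped TensorProduct

/-- The space `𝔽₂^I = ⨂_{i ∈ I} 𝔽₂^{n_i}`, for a set `I` of coordinate directions. -/
abbrev PartialTensor {d : ℕ} (n : Fin d → ℕ) (I : Set (Fin d)) : Type :=
  ⨂[ZMod 2] i : I, (Fin (n i) → ZMod 2)

/-- The space `𝒢 = 𝔽₂^{n_1} ⊗ ⋯ ⊗ 𝔽₂^{n_d}`. -/
abbrev FullTensor {d : ℕ} (n : Fin d → ℕ) : Type :=
  ⨂[ZMod 2] i : Fin d, (Fin (n i) → ZMod 2)

instance FullTensor.instFinite {d : ℕ} (n : Fin d → ℕ) : Finite (FullTensor n) :=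
  Module.finite_of_finite (ZMod 2)

/-- The multiset `ℬ` of all `u_1 ⊗ ⋯ ⊗ u_d` with `u_i ∈ 𝔽₂^{n_i}`: one entry for every tuple
`(u_1, …, u_d)`, tuples with zero entries included. -/
noncomputable def rankOneTensors {d : ℕ} (n : Fin d → ℕ) : Multiset (FullTensor n) :=
  (Finset.univ : Finset ((i : Fin d) → Fin (n i) → ZMod 2)).val.map
    fun u => PiTensorProduct.tprod (ZMod 2) u

/-- `A` is `(B, η)`-closed for a multiset `B`: the number of pairs `(a, b) ∈ A × B` with
`a + b ∈ A`, where `b` is counted with multiplicity, is at least `η |A| |B|`. -/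
def IsMultisetClosed {G : Type*} [AddCommGroup G] [Finite G]
    (A : Set G) (B : Multiset G) (η : ℝ) : Prop :=
  η * (A.ncard : ℝ) * (B.card : ℝ) ≤
    (((B.map fun b => {a : G | a ∈ A ∧ a + b ∈ A}.ncard).sum : ℕ) : ℝ)

open Classical in
/-- The natural isomorphism `𝔽₂^I ⊗ 𝔽₂^{Iᶜ} ≃ 𝒢`. -/
noncomputable def splitEquiv {d : ℕ} (n : Fin d → ℕ) (I : Set (Fin d)) :
    PartialTensor n I ⊗[ZMod 2] PartialTensor n Iᶜ ≃ₗ[ZMod 2] FullTensor n :=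
  (PiTensorProduct.tmulEquivDep (ZMod 2)
      (fun s : I ⊕ (Iᶜ : Set (Fin d)) => Fin (n (Equiv.Set.sumCompl I s)) → ZMod 2)).trans
    (PiTensorProduct.reindex (ZMod 2) (fun i : Fin d => Fin (n i) → ZMod 2)
      (Equiv.Set.sumCompl I).symm).symm

/-- On pure tensors the isomorphism puts the factors back in their places. -/
theorem splitEquiv_tprod {d : ℕ} (n : Fin d → ℕ) (I : Set (Fin d))
    (u : (i : Fin d) → Fin (n i) → ZMod 2) :
    splitEquiv n I
      (PiTensorProduct.tprod (ZMod 2) (fun i : I => u i) ⊗ₜ[ZMod 2]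
        PiTensorProduct.tprod (ZMod 2) (fun i : (Iᶜ : Set (Fin d)) => u i)) =
      PiTensorProduct.tprod (ZMod 2) u := by
  classical
  refine (LinearEquiv.symm_apply_eq _).2 (Eq.trans ?_
    (PiTensorProduct.reindex_tprod (R := ZMod 2) (s := fun i : Fin d => Fin (n i) → ZMod 2)
      (Equiv.Set.sumCompl I).symm u).symm)
  refine (PiTensorProduct.tmulEquivDep_apply (ZMod 2)
    (fun s : I ⊕ (Iᶜ : Set (Fin d)) => Fin (n (Equiv.Set.sumCompl I s)) → ZMod 2)
    (fun i : I => u i) (fun i : (Iᶜ : Set (Fin d)) => u i)).trans ?_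
  congr 1
  funext s
  cases s <;> rfl

/-- The subspace `H ⊗ 𝔽₂^{Iᶜ}` of `𝒢`, for a subspace `H` of `𝔽₂^I`. -/
noncomputable def tensorFull {d : ℕ} (n : Fin d → ℕ) (I : Set (Fin d))
    (H : Submodule (ZMod 2) (PartialTensor n I)) : Submodule (ZMod 2) (FullTensor n) :=
  (LinearMap.range (H.subtype.rTensor (PartialTensor n Iᶜ))).map
    (splitEquiv n I).toLinearMap

/-- `D` is `k`-simple: a translate of `⋂_{I ≠ ∅} H_I ⊗ 𝔽₂^{Iᶜ}`, where every `H_I` is a subspace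
of `𝔽₂^I` of codimension at most `k`. -/
def IsSimpleSet {d : ℕ} (n : Fin d → ℕ) (k : ℕ) (D : Set (FullTensor n)) : Prop :=
  ∃ H : (I : Set (Fin d)) → Submodule (ZMod 2) (PartialTensor n I),
    (∀ I : Set (Fin d), I.Nonempty → Module.finrank (ZMod 2) (PartialTensor n I ⧸ H I) ≤ k) ∧
    ∃ x : FullTensor n,
      D = (fun y => x + y) ''
        ((⨅ (I : Set (Fin d)) (_ : I.Nonempty), tensorFull n I (H I) :
          Submodule (ZMod 2) (FullTensor n)) : Set (FullTensor n))

/-!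
The proof combines a Fourier argument with a uniform rank bound for multilinear forms over `𝔽₂`.

*Reduction to forms.* Let `ℬ'` be given by a set `S` of tuples of density at least `δ`. If `𝒜` is
almost closed under adding elements of `ℬ'`, then most of the Fourier mass of `𝒜` sits on those
functionals `M` on `𝒢` which vanish at almost all `u_1 ⊗ ⋯ ⊗ u_d` with `u ∈ S`. Suppose that all
these `M` annihilate one subspace `V`. Then averaging over `V` changes the indicator function of
`𝒜` only slightly, so some coset of `V` is almost contained in `𝒜` (`exists_coset_of_closed`).
A subspace `V = ⋂ H_I ⊗ 𝔽₂^{Iᶜ}` has this property if every `M` is a sum of products `q * h`, where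
`q` is a form in the coordinates from some `I` which vanishes on `H_I`, and `h` is a form in the other
coordinates (`exists_subspaces_of_family`).

*The uniform rank bound.* It remains to find a bounded family of forms `q` which serves
all `M` that vanish on a proportion `1 - 2 ^ (-d - 1)` of `S` (`uniformRankBound`). The proportion
must not depend on `δ`, because `ε` does not. The proof is by induction on the set of coordinates.

- The bound for fewer coordinates shows that a single form of large bias is a sum of boundedly
  many products of forms in fewer coordinates, since all its slices in one direction
  vanish on a common dense set (`UniformRankBound.biasRankBound`).
- The forms `M` are written as polynomials `Φ (p, L)` in forms `p` that have already been fixed and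
  forms `L` that may depend on `M`; at the start `L` is `M` itself. If each monomial of `Φ`
  contains some `p`, then `M` lies in the span of the family `p` (`IsMultiform.mem_formSpan`).
- Otherwise the polynomial `Φ (a, ·)` takes the value `1` with probability at least `2 ^ (-d)`, for
  all values `a` of the `p` (`IsMultiform.card_le_card_filter_eq_one`). This bound does not involve
  the number of variables. As `M` vanishes on nearly all of `S`, a nontrivial combination of the `L`
  must correlate with `S` on some set where the `p` are constant (`IsMultiform.exists_correlation`).
- By Bessel's inequality, such combinations for different `M` fall into boundedly many classes, in
  each of which the differences are biased (`exists_net`). Bias passes to the part of the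
  difference in a maximal set of coordinates (`IsMultiform.expect_add_sum_pow_le`), which therefore
  is a sum of boundedly many products. Adding one representative of each class to the forms `p`, one
  can express some `L j` by the other `L i` and by forms in fewer coordinates
  (`exists_relation`).
- The multiset of the coordinate sets of the `L` has then decreased in the Dershowitz–Manna
  order, so the process ends after a number of steps bounded in terms of `d` and `δ`
  (`uniformRankBoundFor`).
-/

/-! ### Multihomogeneous functions -/

theorem zmod_two_add_self (a : ZMod 2) : a + a = 0 := CharTwo.add_self_eq_zero a

theorem zmod_two_ne_zero_iff {a : ZMod 2} : a ≠ 0 ↔ a = 1 := by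
  revert a; decide

section Multiform

variable {τ σ ρ : Type*} {V : σ → Type*} [∀ i, AddCommGroup (V i)]

/-- `IsMultiform b I φ` says that `φ` is multilinear in the set `I` of directions. Every variable
`i` carries a set `b i` of directions; the function `φ` has to be additive in the group
of variables `{i | t ∈ b i}` for every `t ∈ I`, and independent of that group for `t ∉ I`.

Two instances matter. If the variables are the directions themselves and `b i = {i}`,
then `φ` is a multilinear form in the coordinates from `I`. If all variables take values in `𝔽₂`,
then `φ` is a polynomial each of whose monomials is a product of variables whose
blocks partition `I`. -/
structure IsMultiform (b : σ → Finset τ) (I : Finset τ) (φ : (∀ i, V i) → ZMod 2) : Prop where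
  indep : ∀ t ∉ I, ∀ x y : ∀ i, V i, (∀ i, t ∉ b i → x i = y i) → φ x = φ y
  add : ∀ t ∈ I, ∀ x y z : ∀ i, V i, (∀ i, t ∉ b i → x i = z i ∧ y i = z i) →
    (∀ i, t ∈ b i → z i = x i + y i) → φ z = φ x + φ y

namespace IsMultiform

variable {b : σ → Finset τ} {I J : Finset τ} {φ ψ : (∀ i, V i) → ZMod 2}

theorem zero : IsMultiform b I (fun _ : ∀ i, V i => (0 : ZMod 2)) :=
  ⟨fun _ _ _ _ _ => rfl, fun _ _ _ _ _ _ _ => by simp⟩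

theorem fun_add (hφ : IsMultiform b I φ) (hψ : IsMultiform b I ψ) :
    IsMultiform b I (fun x => φ x + ψ x) :=
  ⟨fun t ht x y h => by rw [hφ.indep t ht x y h, hψ.indep t ht x y h],
   fun t ht x y z h h' => by rw [hφ.add t ht x y z h h', hψ.add t ht x y z h h']; ring⟩

theorem const_mul (c : ZMod 2) (hφ : IsMultiform b I φ) : IsMultiform b I (fun x => c * φ x) :=
  ⟨fun t ht x y h => by rw [hφ.indep t ht x y h],
   fun t ht x y z h h' => by rw [hφ.add t ht x y z h h']; ring⟩

theorem fun_sum {ι : Type*} {s : Finset ι} {f : ι → (∀ i, V i) → ZMod 2}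
    (h : ∀ i ∈ s, IsMultiform b I (f i)) : IsMultiform b I (fun x => ∑ i ∈ s, f i x) := by
  classical
  induction s using Finset.induction_on with
  | empty => simpa using zero
  | insert i s hi ih =>
    simp only [Finset.sum_insert hi]
    exact (h i (by simp)).fun_add (ih fun j hj => h j (by simp [hj]))

theorem fun_mul [DecidableEq τ] (hφ : IsMultiform b I φ) (hψ : IsMultiform b J ψ)
    (hIJ : Disjoint I J) : IsMultiform b (I ∪ J) (fun x => φ x * ψ x) := by
  refine ⟨fun t ht x y h => ?_, fun t ht x y z h h' => ?_⟩
  · rw [Finset.mem_union, not_or] at ht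
    rw [hφ.indep t ht.1 x y h, hψ.indep t ht.2 x y h]
  · rcases Finset.mem_union.1 ht with ht | ht
    · have hJ : t ∉ J := Finset.disjoint_left.1 hIJ ht
      rw [hφ.add t ht x y z h h', hψ.indep t hJ x z fun i hi => (h i hi).1, add_mul,
        hψ.indep t hJ y z fun i hi => (h i hi).2]
    · have hI : t ∉ I := Finset.disjoint_right.1 hIJ ht
      rw [hψ.add t ht x y z h h', hφ.indep t hI x z fun i hi => (h i hi).1, mul_add,
        hφ.indep t hI y z fun i hi => (h i hi).2]

/-- Substituting multihomogeneous functions for the variables, each of the multidegree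
of the variable that it replaces, preserves multihomogeneity. -/
theorem comp {b' : ρ → Finset τ} {Φ : (ρ → ZMod 2) → ZMod 2} (hΦ : IsMultiform b' I Φ)
    {f : ρ → (∀ i, V i) → ZMod 2} (hf : ∀ r, IsMultiform b (b' r) (f r)) :
    IsMultiform b I (fun x => Φ (fun r => f r x)) :=
  ⟨fun t ht x y h => hΦ.indep t ht _ _ fun r hr => (hf r).indep t hr x y h,
   fun t ht x y z h h' => hΦ.add t ht _ _ _
    (fun r hr => ⟨(hf r).indep t hr x z fun i hi => (h i hi).1,
      (hf r).indep t hr y z fun i hi => (h i hi).2⟩)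
    fun r hr => (hf r).add t hr x y z h h'⟩

/-- A multihomogeneous function depends only on the variables with block contained in `I`. -/
theorem congr_of_subset [Fintype σ] (hφ : IsMultiform b I φ) {x y : ∀ i, V i}
    (h : ∀ i, b i ⊆ I → x i = y i) : φ x = φ y := by
  classical
  have key : ∀ (s : Finset σ) (x y : ∀ i, V i), (∀ i, b i ⊆ I → x i = y i) →
      (∀ i ∉ s, x i = y i) → φ x = φ y := by
    intro s
    induction s using Finset.induction_on with
    | empty => intro x y _ h; congr 1; funext i; exact h i (by simp)
    | insert i s _ ih =>
      intro x y h h'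
      by_cases hi : b i ⊆ I
      · refine ih x y h fun r hr => ?_
        rcases eq_or_ne r i with rfl | hri
        · exact h r hi
        · exact h' r (by simp [hri, hr])
      · obtain ⟨t, hti, htI⟩ := Finset.not_subset.1 hi
        rw [hφ.indep t htI x (Function.update x i (y i)) fun r hr => ?_]
        · refine ih _ _ (fun r hr => ?_) fun r hr => ?_
          · have : r ≠ i := by rintro rfl; exact hi hr
            simpa [this] using h r hr
          · rcases eq_or_ne r i with rfl | hri
            · simp
            · simpa [hri] using h' r (by simp [hri, hr])
        · have : r ≠ i := by rintro rfl; exact hr hti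
          simp [this]
  exact key Finset.univ x y h (by simp)

theorem eq_zero (hφ : IsMultiform b I φ) {t : τ} (ht : t ∈ I) {x : ∀ i, V i}
    (hx : ∀ i, t ∈ b i → x i = 0) : φ x = 0 := by
  have := hφ.add t ht x x x (by simp) fun i hi => by simp [hx i hi]
  simpa using this

end IsMultiform

theorem isMultiform_var {b : σ → Finset τ} (i : σ) :
    IsMultiform b (b i) (fun z : σ → ZMod 2 => z i) :=
  ⟨fun _ ht _ _ h => h i ht, fun _ ht _ _ _ _ h => h i ht⟩

end Multiform

/-! ### Polynomials over `𝔽₂` with multihomogeneous monomials -/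

section Polynomial

variable {τ σ : Type*} [DecidableEq τ] [DecidableEq σ] {b : σ → Finset τ} {I : Finset τ}
  {Φ : (σ → ZMod 2) → ZMod 2}

/-- The derivative of `Φ` in the variable `i`, that is, the coefficient of that variable. -/
def varDeriv (i : σ) (Φ : (σ → ZMod 2) → ZMod 2) (z : σ → ZMod 2) : ZMod 2 :=
  Φ (z + Pi.single i 1) + Φ z


theorem IsMultiform.varDeriv_eq (hΦ : IsMultiform b I Φ) {i : σ} {t : τ} (ht : t ∈ I)
    (hti : t ∈ b i) (z : σ → ZMod 2) :
    varDeriv i Φ z = Φ (fun r => if t ∈ b r then (Pi.single i 1 : σ → ZMod 2) r else z r) := by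
  rw [varDeriv, hΦ.add t ht z (fun r => if t ∈ b r then (Pi.single i 1 : σ → ZMod 2) r else z r)
    (z + Pi.single i 1), add_comm, ← add_assoc, zmod_two_add_self, zero_add]
  · intro r hr
    have : r ≠ i := by rintro rfl; exact hr hti
    simp [hr, this]
  · intro r hr
    simp [hr]

/-- The derivative in a variable is multihomogeneous in the remaining directions. -/
theorem IsMultiform.isMultiform_varDeriv (hΦ : IsMultiform b I Φ) {i : σ} (hi : b i ⊆ I) :
    IsMultiform b (I \ b i) (varDeriv i Φ) := by
  refine ⟨fun t ht x y h => ?_, fun t ht x y z h h' => ?_⟩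
  · by_cases hti : t ∈ b i
    · rw [hΦ.varDeriv_eq (hi hti) hti, hΦ.varDeriv_eq (hi hti) hti]
      congr 1
      funext r
      split_ifs with hr
      · rfl
      · exact h r hr
    · have htI : t ∉ I := fun h' => ht (by simp [h', hti])
      unfold varDeriv
      rw [hΦ.indep t htI x y h, hΦ.indep t htI (x + Pi.single i 1) (y + Pi.single i 1)]
      intro r hr
      simp [h r hr]
  · obtain ⟨htI, hti⟩ := Finset.mem_sdiff.1 ht
    have hs : ∀ r, t ∈ b r → r ≠ i := by rintro r hr rfl; exact hti hr
    unfold varDeriv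
    rw [hΦ.add t htI x y z h h', hΦ.add t htI (x + Pi.single i 1) (y + Pi.single i 1)
      (z + Pi.single i 1)]
    · ring
    · intro r hr
      simp [(h r hr).1, (h r hr).2]
    · intro r hr
      simp [h' r hr, hs r hr]

theorem varDeriv_spec (i : σ) (z : σ → ZMod 2) (c : ZMod 2) :
    Φ (z + Pi.single i c) = Φ z + c * varDeriv i Φ z := by
  unfold varDeriv
  by_cases hc : c = 0
  · simp [hc]
  · rw [zmod_two_ne_zero_iff.1 hc, one_mul, add_left_comm, zmod_two_add_self, add_zero]

/-- If `Φ` does not vanish at `z`, then neither does its derivative in one of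
the variables of any given direction that are nonzero at `z`. -/
theorem IsMultiform.exists_varDeriv_ne_zero [Fintype σ] (hΦ : IsMultiform b I Φ) {t : τ}
    (ht : t ∈ I) {z : σ → ZMod 2} (hz : Φ z ≠ 0) :
    ∃ i, z i ≠ 0 ∧ t ∈ b i ∧ varDeriv i Φ z ≠ 0 := by
  by_contra! hcon
  -- Split the part of `z` in the group of `t` into its single variables.
  have key : ∀ s : Finset σ, Φ (fun r => if t ∈ b r then (if r ∈ s then z r else 0) else z r)
      = 0 := by
    intro s
    induction s using Finset.induction_on with
    | empty => exact hΦ.eq_zero ht fun i hi => by simp [hi]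
    | insert i s his ih =>
      by_cases hi : t ∈ b i ∧ z i ≠ 0
      · have h1 := hcon i hi.2 hi.1
        rw [hΦ.varDeriv_eq ht hi.1] at h1
        have hzi : z i = 1 := zmod_two_ne_zero_iff.1 hi.2
        refine (hΦ.add t ht _ _ _ (fun r hr => ?_) (fun r hr => ?_)).trans
          ((congrArg₂ (· + ·) ih h1).trans (add_zero 0))
        · simp [hr]
        · rcases eq_or_ne r i with rfl | hri
          · simp [hr, his, hzi]
          · simp [hr, hri]
      · refine Eq.trans ?_ ih
        congr 1
        funext r
        rcases eq_or_ne r i with rfl | hri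
        · by_cases hr : t ∈ b r
          · have : z r = 0 := by by_contra h; exact hi ⟨hr, h⟩
            simp [hr, this]
          · simp [hr]
        · simp [hri]
  apply hz
  rw [← key Finset.univ]
  congr 1
  funext r
  simp

end Polynomial

section Zeros

variable {τ π κ : Type*} [DecidableEq τ] [Fintype π] [Fintype κ] [DecidableEq π] [DecidableEq κ]

/-- A polynomial which does not vanish identically once the variables from `π` are set to `0`
takes the value `1` with probability at least `2 ^ (-|I|)`, whatever
fixed values are given to the variables from `π`. -/
theorem IsMultiform.card_le_card_filter_eq_one {b : π ⊕ κ → Finset τ}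
    (hb : ∀ i, (b i).Nonempty) (a : π → ZMod 2) :
    ∀ (I : Finset τ) (Φ : (π ⊕ κ → ZMod 2) → ZMod 2), IsMultiform b I Φ →
      ∀ w₀ : κ → ZMod 2, Φ (Sum.elim 0 w₀) ≠ 0 →
      Fintype.card (κ → ZMod 2) ≤
        2 ^ I.card * (Finset.univ.filter fun w : κ → ZMod 2 => Φ (Sum.elim a w) = 1).card := by
  intro I
  induction I using Finset.strongInduction with
  | H I ih =>
    intro Φ hΦ w₀ hw₀
    rcases I.eq_empty_or_nonempty with rfl | ⟨t, ht⟩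
    · -- Every variable has a direction, so `Φ` is constant.
      have hconst : ∀ w, Φ (Sum.elim a w) = 1 := by
        intro w
        rw [hΦ.congr_of_subset (y := Sum.elim 0 w₀) fun i hi =>
          absurd (Finset.subset_empty.1 hi) (hb i).ne_empty]
        exact zmod_two_ne_zero_iff.1 hw₀
      simp [hconst]
    · obtain ⟨i, hi, hti, hD⟩ := hΦ.exists_varDeriv_ne_zero ht hw₀
      rcases i with i | i
      · simp at hi
      by_cases hbi : b (Sum.inr i) ⊆ I
      · have hlt : I \ b (Sum.inr i) ⊂ I :=
          Finset.sdiff_ssubset hbi (hb _)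
        have h1 := ih _ hlt _ (hΦ.isMultiform_varDeriv hbi) w₀ hD
        have hcard : (I \ b (Sum.inr i)).card + 1 ≤ I.card := Finset.card_lt_card hlt
        set Ψ : (κ → ZMod 2) → ZMod 2 := fun w => Φ (Sum.elim a w) with hΨ
        have hshift : ∀ w, varDeriv (Sum.inr i) Φ (Sum.elim a w) =
            Ψ (w + Pi.single i 1) + Ψ w := by
          intro w
          unfold varDeriv
          simp only [hΨ]
          congr 2
          funext r
          rcases r with r | r
          · simp
          · by_cases h : r = i
            · subst h; simp
            · simp [h]
        have h2 : (Finset.univ.filter fun w : κ → ZMod 2 =>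
            varDeriv (Sum.inr i) Φ (Sum.elim a w) = 1).card ≤
            2 * (Finset.univ.filter fun w : κ → ZMod 2 => Ψ w = 1).card := by
          have hsub : (Finset.univ.filter fun w : κ → ZMod 2 =>
              varDeriv (Sum.inr i) Φ (Sum.elim a w) = 1) ⊆
              (Finset.univ.filter fun w : κ → ZMod 2 => Ψ w = 1) ∪
              (Finset.univ.filter fun w : κ → ZMod 2 => Ψ w = 1).image
                (fun w => w + Pi.single i 1) := by
            intro w hw
            simp only [Finset.mem_filter, Finset.mem_univ, true_and, hshift] at hw
            simp only [Finset.mem_union, Finset.mem_filter, Finset.mem_univ, true_and,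
              Finset.mem_image]
            by_cases h : Ψ w = 1
            · exact Or.inl h
            · refine Or.inr ⟨w + Pi.single i 1, ?_, ?_⟩
              · rw [← zmod_two_ne_zero_iff, not_not] at h
                simpa [h] using hw
              · funext r
                simp [add_assoc, zmod_two_add_self]
          calc _ ≤ _ := Finset.card_le_card hsub
            _ ≤ _ := Finset.card_union_le _ _
            _ ≤ _ := Nat.add_le_add_left Finset.card_image_le _
            _ = _ := by ring
        calc _ ≤ _ := h1
          _ ≤ 2 ^ (I \ b (Sum.inr i)).card *
              (2 * (Finset.univ.filter fun w : κ → ZMod 2 => Ψ w = 1).card) := by gcongr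
          _ = 2 ^ ((I \ b (Sum.inr i)).card + 1) *
              (Finset.univ.filter fun w : κ → ZMod 2 => Ψ w = 1).card := by ring
          _ ≤ _ := Nat.mul_le_mul_right _ (Nat.pow_le_pow_right two_pos hcard)
      · -- `Φ` does not depend on a variable with a direction outside `I`.
        obtain ⟨t', ht', htI⟩ := Finset.not_subset.1 hbi
        refine absurd ?_ hD
        unfold varDeriv
        rw [hΦ.indep t' htI 
          (Sum.elim (0 : π → ZMod 2) w₀ + Pi.single (Sum.inr i) 1) (Sum.elim 0 w₀) fun r hr => ?_]
        · exact zmod_two_add_self _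
        · have : r ≠ Sum.inr i := by rintro rfl; exact hr ht'
          simp [this]

end Zeros

/-! ### Signs and exponential sums -/

/-- The nontrivial character `z ↦ (-1) ^ z` of `𝔽₂`, with real values. -/
def signChar (z : ZMod 2) : ℝ := if z = 0 then 1 else -1

@[simp] theorem signChar_zero : signChar 0 = 1 := if_pos rfl

@[simp] theorem signChar_one : signChar 1 = -1 := if_neg one_ne_zero

theorem signChar_add (a b : ZMod 2) : signChar (a + b) = signChar a * signChar b := by
  by_cases ha : a = 0
  · simp [ha]
  by_cases hb : b = 0
  · simp [hb]
  rw [zmod_two_ne_zero_iff.1 ha, zmod_two_ne_zero_iff.1 hb, zmod_two_add_self]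
  simp

theorem signChar_mul_self (a : ZMod 2) : signChar a * signChar a = 1 := by
  rw [← signChar_add, zmod_two_add_self, signChar_zero]

theorem abs_signChar (a : ZMod 2) : |signChar a| = 1 := by
  unfold signChar; split_ifs <;> simp

theorem signChar_sum {ι : Type*} (s : Finset ι) (f : ι → ZMod 2) :
    signChar (∑ i ∈ s, f i) = ∏ i ∈ s, signChar (f i) := by
  classical
  induction s using Finset.induction_on with
  | empty => simp
  | insert i s hi ih => rw [Finset.sum_insert hi, Finset.prod_insert hi, signChar_add, ih]

theorem sum_signChar_eq {X : Type*} (s : Finset X) (f : X → ZMod 2) :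
    ∑ x ∈ s, signChar (f x) = 2 * ((s.filter fun x => f x = 0).card : ℝ) - s.card := by
  have h : ∀ x, signChar (f x) = 2 * (if f x = 0 then (1 : ℝ) else 0) - 1 := by
    intro x; unfold signChar; split_ifs <;> norm_num
  simp_rw [h]
  rw [Finset.sum_sub_distrib, ← Finset.mul_sum, Finset.sum_boole]
  simp

theorem sum_signChar_eq' {X : Type*} (s : Finset X) (f : X → ZMod 2) :
    ∑ x ∈ s, signChar (f x) = s.card - 2 * ((s.filter fun x => f x = 1).card : ℝ) := by
  have h : ∀ x, signChar (f x) = 1 - 2 * (if f x = 1 then (1 : ℝ) else 0) := by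
    intro x
    by_cases hx : f x = 0
    · simp [hx]
    · rw [zmod_two_ne_zero_iff.1 hx]; norm_num
  simp_rw [h]
  rw [Finset.sum_sub_distrib, ← Finset.mul_sum, Finset.sum_boole]
  simp

/-- A homomorphism from a finite group to `𝔽₂` is balanced unless it is trivial. -/
theorem sum_signChar_addMonoidHom {G : Type*} [AddCommGroup G] [Fintype G] (f : G →+ ZMod 2)
    (hf : f ≠ 0) : ∑ x, signChar (f x) = 0 := by
  obtain ⟨g, hg⟩ := DFunLike.ne_iff.1 hf
  have h : ∑ x, signChar (f x) = - ∑ x, signChar (f x) := by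
    conv_lhs => rw [← Equiv.sum_comp (Equiv.addRight g)]
    simp [signChar_add, zmod_two_ne_zero_iff.1 hg]
  linarith

/-- Orthogonality of the characters of `𝔽₂ ^ κ`. -/
theorem sum_signChar_dotProduct {κ : Type*} [Fintype κ] [DecidableEq κ] (z w : κ → ZMod 2) :
    ∑ α : κ → ZMod 2, signChar (∑ i, α i * (z i + w i)) =
      if w = z then (Fintype.card (κ → ZMod 2) : ℝ) else 0 := by
  split_ifs with h
  · subst h
    simp [zmod_two_add_self]
  · let f : (κ → ZMod 2) →+ ZMod 2 :=
      { toFun := fun α => ∑ i, α i * (z i + w i)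
        map_zero' := by simp
        map_add' := fun α β => by simp [add_mul, Finset.sum_add_distrib] }
    refine sum_signChar_addMonoidHom f fun hf => h ?_
    funext i
    have : f (Pi.single i 1) = 0 := by rw [hf]; rfl
    simp only [f, AddMonoidHom.coe_mk, ZeroHom.coe_mk, Pi.single_apply, ite_mul, one_mul, zero_mul,
      Finset.sum_ite_eq', Finset.mem_univ, if_true] at this
    exact ((CharTwo.add_eq_zero).1 this).symm

/-- A form of Bessel's inequality: a bounded function correlates with few
sign-valued functions that are almost orthogonal to each other. -/
theorem card_le_of_correlation {X β : Type*} [Fintype X] [Nonempty X] {T : Finset β}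
    {F : β → X → ℝ} (hF : ∀ l ∈ T, ∀ x, |F l x| = 1) {g : X → ℝ} (hg : ∀ x, |g x| ≤ 1) {η : ℝ}
    (hη : 0 < η) (hcor : ∀ l ∈ T, η * Fintype.card X ≤ |∑ x, g x * F l x|)
    (hsep : ∀ l ∈ T, ∀ l' ∈ T, l ≠ l' → ∑ x, F l x * F l' x ≤ η ^ 2 / 2 * Fintype.card X ∧
      -(η ^ 2 / 2 * Fintype.card X) ≤ ∑ x, F l x * F l' x) :
    (T.card : ℝ) ≤ 2 / η ^ 2 := by
  classical
  have hN : (0 : ℝ) < Fintype.card X := by exact_mod_cast Fintype.card_pos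
  set N : ℝ := ((Fintype.card X : ℕ) : ℝ) with hNdef
  -- With these signs, `g` correlates with the sum of all `e l * F l` at once.
  set e : β → ℝ := fun l => if 0 ≤ ∑ x, g x * F l x then 1 else -1 with he
  have heabs : ∀ l, |e l| = 1 := by intro l; simp only [he]; split_ifs <;> simp
  have hesq : ∀ l, e l * e l = 1 := by intro l; simp only [he]; split_ifs <;> simp
  have h1 : (T.card : ℝ) * (η * N) ≤ ∑ x, g x * ∑ l ∈ T, e l * F l x := by
    have : ∑ x, g x * ∑ l ∈ T, e l * F l x = ∑ l ∈ T, e l * ∑ x, g x * F l x := by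
      simp_rw [Finset.mul_sum]
      rw [Finset.sum_comm]
      exact Finset.sum_congr rfl fun l _ => Finset.sum_congr rfl fun x _ => by ring
    rw [this, ← nsmul_eq_mul]
    refine Finset.card_nsmul_le_sum _ _ _ fun l hl => (hcor l hl).trans ?_
    simp only [he]
    split_ifs with h
    · rw [abs_of_nonneg h]; linarith
    · rw [abs_of_neg (not_le.1 h)]; linarith
  have h2 : (∑ x, g x * ∑ l ∈ T, e l * F l x) ^ 2 ≤ N * ∑ x, (∑ l ∈ T, e l * F l x) ^ 2 := by
    refine (Finset.sum_mul_sq_le_sq_mul_sq _ _ _).trans ?_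
    gcongr
    calc ∑ x, g x ^ 2 ≤ ∑ x : X, (1 : ℝ) := Finset.sum_le_sum fun x _ => by
          rw [← sq_abs]; nlinarith [hg x, abs_nonneg (g x)]
      _ = N := by simp [N]
  have h3 : ∑ x, (∑ l ∈ T, e l * F l x) ^ 2 ≤ N * (T.card + (T.card : ℝ) ^ 2 * (η ^ 2 / 2)) := by
    have : ∑ x, (∑ l ∈ T, e l * F l x) ^ 2 =
        ∑ l ∈ T, ∑ l' ∈ T, e l * e l' * ∑ x, F l x * F l' x := by
      simp_rw [sq, Finset.sum_mul_sum, Finset.mul_sum]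
      rw [Finset.sum_comm]
      refine Finset.sum_congr rfl fun l _ => ?_
      rw [Finset.sum_comm]
      exact Finset.sum_congr rfl fun l' _ => Finset.sum_congr rfl fun x _ => by ring
    rw [this]
    have hrow : ∀ l ∈ T, ∑ l' ∈ T, e l * e l' * ∑ x, F l x * F l' x ≤
        N * (1 + T.card * (η ^ 2 / 2)) := by
      intro l hl
      have hterm : ∀ l' ∈ T, e l * e l' * ∑ x, F l x * F l' x ≤
          (if l = l' then N else 0) + η ^ 2 / 2 * N := by
        intro l' hl'
        split_ifs with h
        · subst h
          rw [hesq, one_mul]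
          have : ∑ x, F l x * F l x = N := by
            have : ∀ x, F l x * F l x = 1 := fun x => by
              rw [← abs_mul_abs_self, hF l hl x, one_mul]
            simp [this, N]
          rw [this]
          have : 0 ≤ η ^ 2 / 2 * N := by positivity
          linarith
        · have hab := abs_le.2 ⟨(hsep l hl l' hl' h).2, (hsep l hl l' hl' h).1⟩
          refine (le_abs_self _).trans ?_
          rw [abs_mul, abs_mul, heabs, heabs, one_mul, one_mul, zero_add]
          exact hab
      refine (Finset.sum_le_sum hterm).trans ?_
      rw [Finset.sum_add_distrib, Finset.sum_ite_eq, if_pos hl, Finset.sum_const, nsmul_eq_mul]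
      apply le_of_eq; ring
    refine (Finset.sum_le_sum hrow).trans ?_
    rw [Finset.sum_const, nsmul_eq_mul]
    apply le_of_eq; ring
  have h4 : ((T.card : ℝ) * (η * N)) ^ 2 ≤
      N * (N * (T.card + (T.card : ℝ) ^ 2 * (η ^ 2 / 2))) := by
    refine le_trans ?_ (h2.trans (by gcongr))
    exact pow_le_pow_left₀ (by positivity) h1 2
  rw [le_div_iff₀ (by positivity)]
  rcases Nat.eq_zero_or_pos T.card with h0 | h0
  · simp [h0]
  have hT : (0 : ℝ) < T.card := by exact_mod_cast h0
  have h5 : (T.card : ℝ) * η ^ 2 * (N ^ 2 * T.card) ≤ 2 * (N ^ 2 * T.card) := by nlinarith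
  exact le_of_mul_le_mul_right h5 (by positivity)

/-- A maximal separated subset is a net. -/
theorem exists_finset_net {β : Type*} (Λ : Set β) (r : β → β → Prop) (hr : ∀ x ∈ Λ, r x x) (N : ℕ)
    (hN : ∀ T : Finset β, (∀ x ∈ T, x ∈ Λ) → (∀ x ∈ T, ∀ y ∈ T, x ≠ y → ¬ r x y) → T.card ≤ N) :
    ∃ T : Finset β, (∀ x ∈ T, x ∈ Λ) ∧ T.card ≤ N ∧ ∀ x ∈ Λ, ∃ y ∈ T, r x y ∨ r y x := by
  classical
  let P : ℕ → Prop := fun m => ∃ T : Finset β, T.card = m ∧ (∀ x ∈ T, x ∈ Λ) ∧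
    ∀ x ∈ T, ∀ y ∈ T, x ≠ y → ¬ r x y
  have hP0 : P 0 := ⟨∅, by simp⟩
  obtain ⟨T, hT, hTΛ, hsep⟩ := Nat.findGreatest_spec (P := P) (Nat.zero_le N) hP0
  refine ⟨T, hTΛ, hN T hTΛ hsep, fun x hx => ?_⟩
  by_contra! hcon
  have hxT : x ∉ T := fun h => (hcon x h).1 (hr x hx)
  have hΛ' : ∀ y ∈ insert x T, y ∈ Λ := by
    intro y hy
    rcases Finset.mem_insert.1 hy with rfl | hy
    exacts [hx, hTΛ y hy]
  have hsep' : ∀ y ∈ insert x T, ∀ z ∈ insert x T, y ≠ z → ¬ r y z := by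
    intro y hy z hz hyz
    rcases Finset.mem_insert.1 hy with hyx | hyT <;> rcases Finset.mem_insert.1 hz with hzx | hzT
    · exact absurd (hyx.trans hzx.symm) hyz
    · exact hyx ▸ (hcon z hzT).1
    · exact hzx ▸ (hcon y hyT).2
    · exact hsep y hyT z hzT hyz
  have hcard := Finset.card_insert_of_notMem hxT
  have hle := hN _ hΛ' hsep'
  have := Nat.le_findGreatest (P := P) hle ⟨_, rfl, hΛ', hsep'⟩
  omega

/-! ### Multilinear forms and their bias -/

section Forms

variable {d : ℕ}

variable {V : Fin d → Type*} [∀ i, AddCommGroup (V i)]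

/-- `IsForm I φ`: `φ` is a multilinear form in the coordinates from `I`, regarded as a
function of all coordinates. -/
abbrev IsForm (I : Finset (Fin d)) (φ : (∀ i, V i) → ZMod 2) : Prop :=
  IsMultiform (fun i => {i}) I φ

variable {I : Finset (Fin d)} {φ : (∀ i, V i) → ZMod 2}

theorem isForm_iff : IsForm I φ ↔
    (∀ t ∉ I, ∀ x u, φ (Function.update x t u) = φ x) ∧
    ∀ t ∈ I, ∀ x u v, φ (Function.update x t (u + v)) =
      φ (Function.update x t u) + φ (Function.update x t v) := by
  constructor
  · rintro ⟨h1, h2⟩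
    refine ⟨fun t ht x u => h1 t ht _ _ fun i hi => ?_,
      fun t ht x u v => h2 t ht _ _ _ (fun i hi => ?_) fun i hi => ?_⟩
    · simp [Function.update_of_ne (Ne.symm (by simpa using hi))]
    · simp [Function.update_of_ne (Ne.symm (by simpa using hi))]
    · obtain rfl : t = i := by simpa using hi
      simp
  · rintro ⟨h1, h2⟩
    refine ⟨fun t ht x y h => ?_, fun t ht x y z h h' => ?_⟩
    · rw [← h1 t ht x (y t)]
      congr 1
      funext i
      rcases eq_or_ne i t with rfl | hi
      · simp
      · simpa [hi] using h i (by simpa using hi.symm)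
    · have hz : Function.update z t (x t + y t) = z := by
        rw [← h' t (by simp), Function.update_eq_self]
      have hx : Function.update z t (x t) = x := by
        funext i
        rcases eq_or_ne i t with rfl | hi
        · simp
        · simpa [hi] using (h i (by simpa using hi.symm)).1.symm
      have hy : Function.update z t (y t) = y := by
        funext i
        rcases eq_or_ne i t with rfl | hi
        · simp
        · simpa [hi] using (h i (by simpa using hi.symm)).2.symm
      rw [← hz, h2 t ht, hx, hy]

theorem IsMultiform.update_of_notMem (hφ : IsForm I φ) {t : Fin d} (ht : t ∉ I)
    (x : ∀ i, V i) (u : V t) : φ (Function.update x t u) = φ x :=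
  (isForm_iff.1 hφ).1 t ht x u

theorem IsMultiform.update_add (hφ : IsForm I φ) {t : Fin d} (ht : t ∈ I)
    (x : ∀ i, V i) (u v : V t) : φ (Function.update x t (u + v)) =
      φ (Function.update x t u) + φ (Function.update x t v) :=
  (isForm_iff.1 hφ).2 t ht x u v

theorem add_single_eq_update (x : ∀ i, V i) (t : Fin d) (u : V t) :
    x + Pi.single t u = Function.update x t (x t + u) := by
  funext i
  rcases eq_or_ne i t with rfl | hi
  · simp
  · simp [hi]

theorem IsMultiform.add_single (hφ : IsForm I φ) {t : Fin d} (ht : t ∈ I)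
    (x : ∀ i, V i) (u : V t) :
    φ (x + Pi.single t u) = φ x + φ (Function.update x t u) := by
  rw [add_single_eq_update, hφ.update_add ht, Function.update_eq_self]

theorem IsMultiform.add_single_of_notMem (hφ : IsForm I φ) {t : Fin d} (ht : t ∉ I)
    (x : ∀ i, V i) (u : V t) : φ (x + Pi.single t u) = φ x := by
  rw [add_single_eq_update, hφ.update_of_notMem ht]

/-- Fixing the coordinate `t` of a form on `I` gives a form on `I \ {t}`. -/
theorem IsMultiform.slice (hφ : IsForm I φ) (t : Fin d) (u : V t) :
    IsForm (I.erase t) (fun x => φ (Function.update x t u)) := by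
  refine isForm_iff.2 ⟨fun s hs x v => ?_, fun s hs x v w => ?_⟩
  · rcases eq_or_ne s t with rfl | hst
    · simp
    · have hsI : s ∉ I := fun h => hs (by simp [hst, h])
      rw [Function.update_comm hst, hφ.update_of_notMem hsI]
  · obtain ⟨hst, hsI⟩ := Finset.mem_erase.1 hs
    rw [Function.update_comm hst, Function.update_comm hst, Function.update_comm hst,
      hφ.update_add hsI]

open scoped BigOperators in
theorem pow_expect_le {Y : Type*} [Fintype Y] [Nonempty Y] (f : Y → ℝ) (k : ℕ) :
    (𝔼 y, f y) ^ 2 ^ k ≤ 𝔼 y, f y ^ 2 ^ k := by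
  induction k with
  | zero => simp
  | succ k ih =>
    have hsq : ∀ g : Y → ℝ, (𝔼 y, g y) ^ 2 ≤ 𝔼 y, g y ^ 2 := fun g => by
      have := Finset.expect_mul_sq_le_sq_mul_sq Finset.univ g 1
      simpa using this
    cases k with
    | zero => simpa using hsq f
    | succ k =>
      rw [pow_succ 2 (k + 1), pow_mul]
      simp_rw [pow_mul]
      refine le_trans ?_ (hsq _)
      refine pow_le_pow_left₀ ?_ ih 2
      rw [pow_succ 2 k, pow_mul]
      exact sq_nonneg _

variable [∀ i, Fintype (V i)]

open scoped BigOperators in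
theorem expect_add_single (g : (∀ i, V i) → ℝ) (t : Fin d) (u : V t) :
    𝔼 x : ∀ i, V i, g (x + Pi.single t u) = 𝔼 x : ∀ i, V i, g x :=
  Fintype.expect_equiv (Equiv.addRight (Pi.single t u)) _ _ fun _ => rfl

open scoped BigOperators in
theorem expect_expect_add_single_sq (F : (∀ i, V i) → ℝ) (t : Fin d) :
    𝔼 x : ∀ i, V i, (𝔼 u : V t, F (x + Pi.single t u)) ^ 2 =
      𝔼 u : V t, 𝔼 x : ∀ i, V i, F x * F (x + Pi.single t u) := by
  have h1 : ∀ x : (∀ i, V i), (𝔼 u : V t, F (x + Pi.single t u)) ^ 2 =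
      𝔼 u : V t, 𝔼 v : V t,
        F (x + Pi.single t u) * F (x + Pi.single t v) := fun x => by
    rw [sq, Fintype.expect_mul_expect]
  have h2 : ∀ u : V t, 𝔼 x : ∀ i, V i, 𝔼 v : V t,
      F (x + Pi.single t u) * F (x + Pi.single t v) =
      𝔼 x : ∀ i, V i, 𝔼 v : V t, F x * F (x + Pi.single t v) := fun u => by
    refine Eq.trans ?_ (expect_add_single
      (fun x : (∀ i, V i) => 𝔼 v : V t, F x * F (x + Pi.single t v)) t u)
    refine Finset.expect_congr rfl fun x _ => ?_
    refine Fintype.expect_equiv (Equiv.subRight u) _ _ fun v => ?_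
    rw [Equiv.subRight_apply, add_assoc, ← Pi.single_add, add_sub_cancel]
  rw [Finset.expect_congr rfl fun x _ => h1 x, Finset.expect_comm,
    Finset.expect_congr rfl fun u _ => h2 u, Finset.expect_const Finset.univ_nonempty,
    Finset.expect_comm]

open scoped BigOperators in
theorem expect_expect_update (g : (∀ i, V i) → ℝ) (t : Fin d) :
    𝔼 u : V t, 𝔼 x : ∀ i, V i, g (Function.update x t u) = 𝔼 x : ∀ i, V i, g x := by
  have h : ∀ x : (∀ i, V i), 𝔼 u : V t, g (Function.update x t u) =
      𝔼 u : V t, g (x + Pi.single t u) := fun x =>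
    Fintype.expect_equiv (Equiv.subRight (x t)) _ _ fun u => by
      rw [add_single_eq_update, Equiv.subRight_apply, add_sub_cancel]
  rw [Finset.expect_comm, Finset.expect_congr rfl fun x _ => h x, Finset.expect_comm,
    Finset.expect_congr rfl fun u _ => expect_add_single g t u,
    Finset.expect_const Finset.univ_nonempty]

open scoped BigOperators in
/-- The Gowers–Cauchy–Schwarz inequality for a form `φ` on `I`: multiplying `(-1) ^ φ` by bounded
functions, one for each `t ∈ I`, which do not depend on the coordinate `t`, does
not create much bias if there was none. -/
theorem IsMultiform.expect_mul_prod_pow_le :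
    ∀ (I : Finset (Fin d)) (φ : (∀ i, V i) → ZMod 2), IsForm I φ → ∀ R : Fin d → (∀ i, V i) → ℝ,
      (∀ t x, |R t x| ≤ 1) → (∀ t ∈ I, ∀ x u, R t (x + Pi.single t u) = R t x) →
      (𝔼 x : ∀ i, V i, signChar (φ x) * ∏ t ∈ I, R t x) ^ 2 ^ I.card ≤
        𝔼 x : ∀ i, V i, signChar (φ x) := by
  intro I
  induction I using Finset.induction_on with
  | empty => intro φ _ R _ _; simp
  | insert t I ht ih =>
    intro φ hφ R hR hinv
    set F : (∀ i, V i) → ℝ := fun x => signChar (φ x) * ∏ s ∈ I, R s x with hF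
    have h1 : 𝔼 x : ∀ i, V i, signChar (φ x) * ∏ s ∈ insert t I, R s x =
        𝔼 x : ∀ i, V i, R t x * 𝔼 u, F (x + Pi.single t u) := by
      calc 𝔼 x : ∀ i, V i, signChar (φ x) * ∏ s ∈ insert t I, R s x = 𝔼 x : ∀ i, V i, R t x * F x :=
            Finset.expect_congr rfl fun x _ => by
              rw [Finset.prod_insert ht]; simp only [hF]; ring
        _ = 𝔼 u : V t, 𝔼 x : ∀ i, V i, R t x * F (x + Pi.single t u) := by
            rw [← Fintype.expect_const (ι := V t) (𝔼 x : ∀ i, V i, R t x * F x)]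
            refine Finset.expect_congr rfl fun u _ => ?_
            refine (expect_add_single (fun x : (∀ i, V i) => R t x * F x) t u).symm.trans ?_
            exact Finset.expect_congr rfl fun x _ => by
              rw [hinv t (Finset.mem_insert_self _ _)]
        _ = _ := by
            rw [Finset.expect_comm]
            exact Finset.expect_congr rfl fun x _ => (Finset.mul_expect _ _ _).symm
    -- After Cauchy–Schwarz the factor `R t` is gone and `φ` has lost the coordinate `t`.
    have h2 : (𝔼 x : ∀ i, V i, signChar (φ x) * ∏ s ∈ insert t I, R s x) ^ 2 ≤
        𝔼 u : V t, 𝔼 x : ∀ i, V i, F x * F (x + Pi.single t u) := by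
      rw [h1]
      refine (Finset.expect_mul_sq_le_sq_mul_sq _ _ _).trans ?_
      have hR1 : 𝔼 x : ∀ i, V i, R t x ^ 2 ≤ 1 := by
        refine Finset.expect_le Finset.univ_nonempty fun x _ => ?_
        rw [← sq_abs]
        nlinarith [hR t x, abs_nonneg (R t x)]
      refine (mul_le_of_le_one_left (Finset.expect_nonneg fun x _ => sq_nonneg _) hR1).trans
        (le_of_eq ?_)
      exact expect_expect_add_single_sq F t
    have h3 : ∀ u : V t, (𝔼 x : ∀ i, V i, F x * F (x + Pi.single t u)) ^ 2 ^ I.card ≤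
        𝔼 x : ∀ i, V i, signChar (φ (Function.update x t u)) := by
      intro u
      have hform := hφ.slice t u
      rw [Finset.erase_insert ht] at hform
      have := ih _ hform (fun s x => R s x * R s (x + Pi.single t u))
        (fun s x => by
          rw [abs_mul]; exact mul_le_one₀ (hR s _) (abs_nonneg _) (hR s _))
        (fun s hs x v => by
          rw [hinv s (Finset.mem_insert_of_mem hs), add_right_comm,
            hinv s (Finset.mem_insert_of_mem hs)])
      refine le_of_eq_of_le ?_ this
      congr 1
      refine Finset.expect_congr rfl fun x _ => ?_
      simp only [hF]
      rw [Finset.prod_mul_distrib, hφ.add_single (Finset.mem_insert_self _ _), signChar_add]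
      linear_combination (∏ s ∈ I, R s x) * (∏ s ∈ I, R s (x + Pi.single t u)) *
        signChar (φ (Function.update x t u)) * signChar_mul_self (φ x)
    rw [Finset.card_insert_of_notMem ht, pow_succ', pow_mul]
    refine (pow_le_pow_left₀ (sq_nonneg _) h2 _).trans ?_
    refine (pow_expect_le (fun u : V t => 𝔼 x : ∀ i, V i, F x * F (x + Pi.single t u))
      I.card).trans ?_
    rw [← expect_expect_update (fun x => signChar (φ x)) t]
    exact Finset.expect_le_expect fun u _ => h3 u

open scoped BigOperators in
/-- Adding forms on sets that do not contain `I` to a form `φ` on `I` cannot create bias. -/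
theorem IsMultiform.expect_add_sum_pow_le (hφ : IsForm I φ) {ι : Type*} (s : Finset ι)
    (b : ι → Finset (Fin d)) (ψ : ι → (∀ i, V i) → ZMod 2) (hψ : ∀ i ∈ s, IsForm (b i) (ψ i))
    (hb : ∀ i ∈ s, ¬ I ⊆ b i) :
    (𝔼 x : ∀ i, V i, signChar (φ x + ∑ i ∈ s, ψ i x)) ^ 2 ^ I.card ≤
      𝔼 x : ∀ i, V i, signChar (φ x) := by
  classical
  rcases isEmpty_or_nonempty (Fin d) with hd | hd
  · have hI : I = ∅ := Finset.eq_empty_of_isEmpty I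
    have hs : s = ∅ := Finset.eq_empty_of_forall_notMem fun i hi => hb i hi (by simp [hI])
    simp [hI, hs]
  choose! t htI htb using fun i hi => Finset.not_subset.1 (hb i hi)
  have h := IsMultiform.expect_mul_prod_pow_le I φ hφ
    (fun r x => ∏ i ∈ s with t i = r, signChar (ψ i x))
    (fun r x => by
      rw [Finset.abs_prod]
      exact (Finset.prod_eq_one fun i _ => abs_signChar _).le)
    (fun r _ x u => by
      refine Finset.prod_congr rfl fun i hi => ?_
      obtain ⟨his, rfl⟩ := Finset.mem_filter.1 hi
      rw [(hψ i his).add_single_of_notMem (htb i his)])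
  refine le_of_eq_of_le ?_ h
  congr 1
  refine Finset.expect_congr rfl fun x _ => ?_
  rw [signChar_add, signChar_sum, Finset.prod_fiberwise_of_maps_to (fun i hi => htI i hi)]

end Forms

section Tuples

variable {d : ℕ}

/-- The tuples `(u_1, …, u_d)` with `u_i ∈ 𝔽₂^{n_i}`. -/
abbrev Tuples (n : Fin d → ℕ) : Type := (i : Fin d) → Fin (n i) → ZMod 2

theorem IsMultiform.eq_sum_coord {n : Fin d → ℕ} {I : Finset (Fin d)} {φ : Tuples n → ZMod 2}
    (hφ : IsForm I φ) {t : Fin d} (ht : t ∈ I) (x : Tuples n) :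
    φ x = ∑ s, x t s * φ (Function.update x t (Pi.single s 1)) := by
  let f : (Fin (n t) → ZMod 2) →+ ZMod 2 :=
    AddMonoidHom.mk' (fun u => φ (Function.update x t u)) (hφ.update_add ht x)
  have h : f (x t) = ∑ s, f (Pi.single s (x t s)) := by
    rw [← map_sum, Finset.univ_sum_single]
  have h0 : φ x = f (x t) := by simp [f]
  rw [h0, h]
  refine Finset.sum_congr rfl fun s _ => ?_
  by_cases hs : x t s = 0
  · rw [hs, Pi.single_zero, map_zero, zero_mul]
  · rw [zmod_two_ne_zero_iff.1 hs, one_mul]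
    rfl

theorem isForm_coord {n : Fin d → ℕ} (t : Fin d) (s : Fin (n t)) :
    IsForm {t} (fun x : Tuples n => x t s) := by
  refine isForm_iff.2 ⟨fun r hr x u => ?_, fun r hr x u v => ?_⟩
  · have : t ≠ r := fun h => hr (by simp [h])
    simp [Function.update_of_ne this]
  · obtain rfl := Finset.mem_singleton.1 hr
    simp

end Tuples

/-! ### Families of forms of bounded size -/

section Families

variable {d : ℕ} {n : Fin d → ℕ} {I : Finset (Fin d)}

/-- A family of forms on nonempty subsets of `I`, each member recorded with its set. -/
def IsFormFamily (I : Finset (Fin d)) (Q : Finset (Finset (Fin d) × (Tuples n → ZMod 2))) : Prop :=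
  ∀ q ∈ Q, q.1.Nonempty ∧ q.1 ⊆ I ∧ IsForm q.1 q.2

/-- The forms on `I` that are sums of products `q * h`, where `q` is a member of the family `Q` and
`h` is a form in the remaining coordinates from `I`. -/
def formSpan (I : Finset (Fin d)) (Q : Finset (Finset (Fin d) × (Tuples n → ZMod 2))) :
    Submodule (ZMod 2) (Tuples n → ZMod 2) :=
  Submodule.span (ZMod 2) {f | ∃ q ∈ Q, ∃ h, IsForm (I \ q.1) h ∧ f = fun x => q.2 x * h x}

theorem formSpan_mono {Q Q' : Finset (Finset (Fin d) × (Tuples n → ZMod 2))} (h : Q ⊆ Q') :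
    formSpan I Q ≤ formSpan I Q' :=
  Submodule.span_mono fun _ ⟨q, hq, hf⟩ => ⟨q, h hq, hf⟩

theorem exists_eq_sum_of_mem_formSpan {Q : Finset (Finset (Fin d) × (Tuples n → ZMod 2))}
    {M : Tuples n → ZMod 2} (hM : M ∈ formSpan I Q) :
    ∃ h : Finset (Fin d) × (Tuples n → ZMod 2) → Tuples n → ZMod 2,
      (∀ q, IsForm (I \ q.1) (h q)) ∧ ∀ x, M x = ∑ q ∈ Q, q.2 x * h q x := by
  classical
  induction hM using Submodule.span_induction with
  | mem f hf =>
    obtain ⟨q, hq, h, hh, rfl⟩ := hf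
    refine ⟨fun q' => if q' = q then h else fun _ => 0, fun q' => ?_, fun x => ?_⟩
    · dsimp only
      split_ifs with hqq
      · rwa [hqq]
      · exact IsMultiform.zero
    · rw [Finset.sum_eq_single_of_mem q hq]
      · simp
      · intro q' _ hqq
        simp [hqq]
  | zero => exact ⟨fun _ _ => 0, fun _ => IsMultiform.zero, by simp⟩
  | add f f' _ _ hf hf' =>
    obtain ⟨h, hh, e⟩ := hf
    obtain ⟨h', hh', e'⟩ := hf'
    refine ⟨fun q x => h q x + h' q x, fun q => (hh q).fun_add (hh' q), fun x => ?_⟩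
    simp [e, e', mul_add, Finset.sum_add_distrib]
  | smul c f _ hf =>
    obtain ⟨h, hh, e⟩ := hf
    refine ⟨fun q x => c * h q x, fun q => (hh q).const_mul c, fun x => ?_⟩
    simp only [Pi.smul_apply, smul_eq_mul, e, Finset.mul_sum]
    exact Finset.sum_congr rfl fun q _ => by ring

/-- A polynomial expression in forms, all of whose monomials contain one of the forms `p u`,
lies in the span of the family `p`. -/
theorem IsMultiform.mem_formSpan {π κ : Type*} [Fintype π] [DecidableEq π] [DecidableEq κ]
    {b : π ⊕ κ → Finset (Fin d)} (hb : ∀ i, b i ⊆ I) {Φ : (π ⊕ κ → ZMod 2) → ZMod 2}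
    (hΦ : IsMultiform b I Φ) {f : π ⊕ κ → Tuples n → ZMod 2} (hf : ∀ i, IsForm (b i) (f i))
    (h0 : ∀ w : κ → ZMod 2, Φ (Sum.elim 0 w) = 0)
    {Q : Finset (Finset (Fin d) × (Tuples n → ZMod 2))}
    (hQ : ∀ u, (b (Sum.inl u), f (Sum.inl u)) ∈ Q) :
    (fun x => Φ (fun i => f i x)) ∈ formSpan I Q := by
  let F : Finset π → π ⊕ κ → Tuples n → ZMod 2 := fun s =>
    Sum.elim (fun u => if u ∈ s then f (Sum.inl u) else fun _ => 0) (fun i => f (Sum.inr i))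
  have hF : ∀ s i, IsForm (b i) (F s i) := by
    intro s i
    rcases i with u | i
    · simp only [F, Sum.elim_inl]
      split_ifs
      exacts [hf _, IsMultiform.zero]
    · exact hf _
  -- The forms `p u` are put in place of zeros one after the other.
  have key : ∀ s : Finset π, (fun x => Φ (fun i => F s i x)) ∈ formSpan I Q := by
    intro s
    induction s using Finset.induction_on with
    | empty =>
      convert Submodule.zero_mem (formSpan I Q)
      rename_i x
      rw [Pi.zero_apply, ← h0 fun i => f (Sum.inr i) x]
      congr 1
      funext i
      rcases i with u | i <;> simp [F]
    | insert u s hu ih =>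
      have hstep : (fun x => Φ (fun i => F (insert u s) i x)) = (fun x => Φ (fun i => F s i x)) +
          fun x => f (Sum.inl u) x * varDeriv (Sum.inl u) Φ (fun i => F s i x) := by
        funext x
        rw [Pi.add_apply, ← varDeriv_spec]
        congr 1
        funext i
        rcases i with u' | i
        · rcases eq_or_ne u' u with rfl | huu
          · simp [F, hu]
          · simp [F, huu]
        · simp [F]
      rw [hstep]
      refine Submodule.add_mem _ ih (Submodule.subset_span ⟨_, hQ u, _, ?_, rfl⟩)
      exact (hΦ.isMultiform_varDeriv (hb (Sum.inl u))).comp (hF s)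
  convert key Finset.univ using 4 with x i
  rcases i with u | i <;> simp [F]

/-- Enumeration of a finite set by `Fin K`, with room left over. -/
theorem exists_fin_option_enum {β : Type*} (s : Finset β) {K : ℕ} (hK : s.card ≤ K) :
    ∃ e : Fin K → Option β, (∀ r q, e r = some q → q ∈ s) ∧ (∀ q ∈ s, ∃ r, e r = some q) ∧
      ∀ F : β → ZMod 2, ∑ q ∈ s, F q = ∑ r, (e r).elim 0 F := by
  classical
  obtain ⟨f⟩ := Function.Embedding.nonempty_of_card_le (α := s) (β := Fin K) (by simpa using hK)
  have hleft : ∀ q, Function.partialInv f (f q) = some q := Function.partialInv_left f.injective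
  refine ⟨fun r => (Function.partialInv f r).map Subtype.val, fun r q h => ?_, fun q hq => ?_,
    fun F => ?_⟩
  · obtain ⟨q', -, rfl⟩ := Option.map_eq_some_iff.1 h
    exact q'.2
  · exact ⟨f ⟨q, hq⟩, by simp [hleft]⟩
  · rw [← Finset.sum_coe_sort]
    refine Fintype.sum_of_injective f f.injective _ _ (fun r hr => ?_) fun q => ?_
    · have : Function.partialInv f r = none := by
        unfold Function.partialInv
        rw [dif_neg]
        rintro ⟨q, hq⟩
        exact hr ⟨q, hq⟩
      simp [this]
    · simp [hleft]

end Families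

/-! ### Biased forms have small partition rank -/

section BiasRank

variable {d : ℕ}

/-- For every density `δ` there is a bound `K` such that, for a set `S` of density at least `δ`,
all forms on `I` which vanish on almost all of `S` lie in the span of one family of at most `K`
forms. "Almost all" means a proportion `1 - 2 ^ (-|I| - 1)`, which does not depend on `δ`. -/
def UniformRankBound (I : Finset (Fin d)) : Prop :=
  ∀ δ : ℝ, 0 < δ → ∃ K : ℕ, ∀ (n : Fin d → ℕ) (S : Finset (Tuples n)),
    δ * Fintype.card (Tuples n) ≤ S.card →
    ∃ Q : Finset (Finset (Fin d) × (Tuples n → ZMod 2)), IsFormFamily I Q ∧ Q.card ≤ K ∧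
      ∀ M : Tuples n → ZMod 2, IsForm I M →
        (1 - 1 / 2 ^ (I.card + 1) : ℝ) * S.card ≤ ((S.filter fun x => M x = 0).card : ℝ) →
        M ∈ formSpan I Q

open scoped BigOperators in
/-- Forms on `I` of bias at least `δ` are sums of boundedly many products of
forms on proper nonempty subsets of `I`. -/
def BiasRankBound (I : Finset (Fin d)) : Prop :=
  ∀ δ : ℝ, 0 < δ → ∃ R : ℕ, ∀ (n : Fin d → ℕ) (M : Tuples n → ZMod 2), IsForm I M →
    δ ≤ 𝔼 x : Tuples n, signChar (M x) →
    ∃ g h : Finset (Fin d) → Fin R → Tuples n → ZMod 2,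
      (∀ J ∈ I.ssubsets.erase ∅, ∀ r, IsForm J (g J r) ∧ IsForm (I \ J) (h J r)) ∧
      ∀ x, M x = ∑ J ∈ I.ssubsets.erase ∅, ∑ r, g J r x * h J r x

open scoped BigOperators in
/-- The bias of a form is the density of the points at which all its
values on the line in direction `t` vanish. -/
theorem IsMultiform.expect_signChar_eq {n : Fin d → ℕ} {I : Finset (Fin d)} {M : Tuples n → ZMod 2}
    (hM : IsForm I M) {t : Fin d} (ht : t ∈ I) :
    (𝔼 x : Tuples n, signChar (M x)) * Fintype.card (Tuples n) =
      ((Finset.univ.filter fun x : Tuples n => ∀ u, M (Function.update x t u) = 0).card : ℝ) := by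
  classical
  have hx : ∀ x : Tuples n, 𝔼 u : Fin (n t) → ZMod 2, signChar (M (Function.update x t u)) =
      if ∀ u, M (Function.update x t u) = 0 then 1 else 0 := by
    intro x
    split_ifs with h
    · simp [h]
    · let f : (Fin (n t) → ZMod 2) →+ ZMod 2 :=
        AddMonoidHom.mk' (fun u => M (Function.update x t u)) (hM.update_add ht x)
      have := sum_signChar_addMonoidHom f fun hf => h fun u => DFunLike.congr_fun hf u
      rw [Fintype.expect_eq_sum_div_card]
      exact (congrArg (· / (_ : ℝ)) this).trans (zero_div _)
  rw [← expect_expect_update (fun x => signChar (M x)) t, Finset.expect_comm,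
    Finset.expect_congr rfl fun x _ => hx x, mul_comm, Fintype.card_mul_expect, Finset.sum_boole]

/-- All slices of a biased form vanish on a common dense set, to
which the uniform bound for forms in fewer coordinates applies. -/
theorem UniformRankBound.biasRankBound {I : Finset (Fin d)} {t : Fin d} (ht : t ∈ I)
    (hU : UniformRankBound (I.erase t)) : BiasRankBound I := by
  classical
  intro δ hδ
  obtain ⟨K, hK⟩ := hU δ hδ
  refine ⟨K, fun n M hM hbias => ?_⟩
  set Z := Finset.univ.filter fun x : Tuples n => ∀ u, M (Function.update x t u) = 0 with hZ
  obtain ⟨Q, hQ, hQK, hQM⟩ := hK n Z (by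
    rw [hZ, ← hM.expect_signChar_eq ht]
    gcongr)
  have hslice : ∀ s : Fin (n t), (fun x => M (Function.update x t (Pi.single s 1))) ∈
      formSpan (I.erase t) Q := by
    intro s
    refine hQM _ (hM.slice t _) ?_
    have hall : (Z.filter fun x => M (Function.update x t (Pi.single s 1)) = 0) = Z :=
      Finset.filter_true_of_mem fun x hx => (Finset.mem_filter.1 hx).2 _
    rw [hall]
    have : (0 : ℝ) ≤ 1 / 2 ^ ((I.erase t).card + 1) := by positivity
    nlinarith [(Nat.cast_nonneg Z.card : (0 : ℝ) ≤ Z.card)]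
  choose h hh hsum using fun s => exists_eq_sum_of_mem_formSpan (hslice s)
  set H : Finset (Fin d) × (Tuples n → ZMod 2) → Tuples n → ZMod 2 :=
    fun q x => ∑ s, x t s * h s q x with hH
  have hHform : ∀ q ∈ Q, IsForm (I \ q.1) (H q) := by
    intro q hq
    refine IsMultiform.fun_sum fun s _ => ?_
    have htq : t ∉ q.1 := fun h => by simpa using (hQ q hq).2.1 h
    have hset : I \ q.1 = {t} ∪ (I.erase t \ q.1) := by
      ext r
      simp only [Finset.mem_sdiff, Finset.mem_union, Finset.mem_singleton, Finset.mem_erase]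
      rcases eq_or_ne r t with rfl | hr
      · simp [ht, htq]
      · simp [hr]
    rw [hset]
    exact (isForm_coord t s).fun_mul (hh s q) (by simp)
  have hMsum : ∀ x, M x = ∑ q ∈ Q, q.2 x * H q x := by
    intro x
    rw [hM.eq_sum_coord ht]
    simp_rw [hsum, hH, Finset.mul_sum]
    rw [Finset.sum_comm]
    exact Finset.sum_congr rfl fun q _ => Finset.sum_congr rfl fun s _ => by ring
  have hmaps : ∀ q ∈ Q, q.1 ∈ I.ssubsets.erase ∅ := by
    intro q hq
    obtain ⟨hne, hsub, -⟩ := hQ q hq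
    rw [Finset.mem_erase, Finset.mem_ssubsets]
    exact ⟨hne.ne_empty, hsub.trans_ssubset (Finset.erase_ssubset ht)⟩
  choose e he _ hesum using fun J : Finset (Fin d) =>
    exists_fin_option_enum (Q.filter fun q => q.1 = J) ((Finset.card_filter_le _ _).trans hQK)
  refine ⟨fun J r => (e J r).elim (fun _ => 0) Prod.snd, fun J r => (e J r).elim (fun _ => 0) H,
    fun J _ r => ?_, fun x => ?_⟩
  · dsimp only
    cases her : e J r with
    | none => exact ⟨IsMultiform.zero, IsMultiform.zero⟩
    | some q =>
      obtain ⟨hq, rfl⟩ := Finset.mem_filter.1 (he J r q her)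
      exact ⟨(hQ q hq).2.2, hHform q hq⟩
  · rw [hMsum, ← Finset.sum_fiberwise_of_maps_to hmaps]
    refine Finset.sum_congr rfl fun J _ => ?_
    rw [hesum]
    refine Finset.sum_congr rfl fun r _ => ?_
    dsimp only
    cases e J r <;> simp

theorem uniformRankBound_empty : UniformRankBound (∅ : Finset (Fin d)) := by
  intro δ hδ
  refine ⟨0, fun n S hS => ⟨∅, by simp [IsFormFamily], by simp, fun M hM hz => ?_⟩⟩
  have hS0 : (0 : ℝ) < S.card :=
    lt_of_lt_of_le (mul_pos hδ (by exact_mod_cast Fintype.card_pos)) hS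
  have : (0 : ℝ) < ((S.filter fun x => M x = 0).card : ℝ) :=
    lt_of_lt_of_le (by rw [Finset.card_empty]; linarith) hz
  obtain ⟨x₀, hx₀⟩ := Finset.card_pos.1 (by exact_mod_cast this)
  have hconst : M = 0 := by
    funext y
    rw [hM.congr_of_subset (y := x₀) fun i hi => by simp at hi]
    exact (Finset.mem_filter.1 hx₀).2
  rw [hconst]
  exact Submodule.zero_mem _

end BiasRank

/-! ### Correlation with a combination of the forms in a polynomial expression -/

section Correlation

variable {d : ℕ} {X π κ : Type*} [Fintype X] [Nonempty X] [Fintype π] [DecidableEq π]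
  [Fintype κ] [DecidableEq κ]

/-- If the polynomial expression `Φ (p, L)` vanishes on almost all of `S`, and not every monomial of
`Φ` contains a variable `p u`, then on one of the sets on which all `p u` are constant, `S`
correlates with a nontrivial linear combination of the functions `L i`. -/
theorem IsMultiform.exists_correlation {I : Finset (Fin d)} {b : π ⊕ κ → Finset (Fin d)}
    (hb : ∀ i, (b i).Nonempty) {Φ : (π ⊕ κ → ZMod 2) → ZMod 2} (hΦ : IsMultiform b I Φ)
    {w₀ : κ → ZMod 2} (hw₀ : Φ (Sum.elim 0 w₀) ≠ 0) (p : π → X → ZMod 2) (L : κ → X → ZMod 2)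
    {S : Finset X} {δ : ℝ} (hδ : 0 < δ) (hS : δ * Fintype.card X ≤ S.card)
    (hzero : (1 - 1 / 2 ^ (I.card + 1) : ℝ) * S.card ≤
      ((S.filter fun x => Φ (Sum.elim (fun u => p u x) fun i => L i x) = 0).card : ℝ)) :
    ∃ (a : π → ZMod 2) (α : κ → ZMod 2), α ≠ 0 ∧
      δ / 2 ^ (I.card + 1) / (Fintype.card (π → ZMod 2) * Fintype.card (κ → ZMod 2)) *
          Fintype.card X ≤
        |∑ x ∈ S.filter fun x => (fun u => p u x) = a, signChar (∑ i, α i * L i x)| := by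
  by_contra! hcon
  set η := δ / 2 ^ (I.card + 1) / (Fintype.card (π → ZMod 2) * Fintype.card (κ → ZMod 2) : ℝ)
    with hη
  have hX : (0 : ℝ) < Fintype.card X := by exact_mod_cast Fintype.card_pos
  have hP : (0 : ℝ) < Fintype.card (π → ZMod 2) := by exact_mod_cast Fintype.card_pos
  have hK : (0 : ℝ) < Fintype.card (κ → ZMod 2) := by exact_mod_cast Fintype.card_pos
  set N : ℝ := ((Fintype.card X : ℕ) : ℝ) with hN
  set P : ℝ := ((Fintype.card (π → ZMod 2) : ℕ) : ℝ) with hPdef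
  set K : ℝ := ((Fintype.card (κ → ZMod 2) : ℕ) : ℝ) with hKdef
  set ε : ℝ := 1 / 2 ^ (I.card + 1) with hε
  have hε0 : 0 < ε := by positivity
  set M : X → ZMod 2 := fun x => Φ (Sum.elim (fun u => p u x) fun i => L i x) with hM
  set Sa : (π → ZMod 2) → Finset X := fun a => S.filter fun x => (fun u => p u x) = a with hSa
  -- On average over all values of the variables from `κ`, the polynomial is not biased to `0`.
  have hbias : ∀ a : π → ZMod 2, ∑ w : κ → ZMod 2, signChar (Φ (Sum.elim a w)) ≤
      (1 - 4 * ε) * K := by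
    intro a
    rw [sum_signChar_eq']
    have h1 : K ≤ 2 ^ I.card *
        ((Finset.univ.filter fun w : κ → ZMod 2 => Φ (Sum.elim a w) = 1).card : ℝ) := by
      rw [hKdef]
      exact_mod_cast hΦ.card_le_card_filter_eq_one hb a I Φ w₀ hw₀
    have h2 : (2 : ℝ) ^ I.card * (2 * ε) = 1 := by
      rw [hε, pow_succ]; field_simp
    have h3 : 2 * ε * K ≤
        ((Finset.univ.filter fun w : κ → ZMod 2 => Φ (Sum.elim a w) = 1).card : ℝ) := by
      have := mul_le_mul_of_nonneg_left h1 (by positivity : 0 ≤ 2 * ε)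
      refine this.trans (le_of_eq ?_)
      rw [← mul_assoc, mul_comm (2 * ε), h2, one_mul]
    rw [Finset.card_univ]
    linarith
  -- Expansion of the sign of `Φ` into characters on a set where the `p u` are constant.
  have hexp : ∀ a, K * ∑ x ∈ Sa a, signChar (M x) =
      ∑ α : κ → ZMod 2, (∑ w : κ → ZMod 2, signChar (Φ (Sum.elim a w)) *
        signChar (∑ i, α i * w i)) * ∑ x ∈ Sa a, signChar (∑ i, α i * L i x) := by
    intro a
    have hpt : ∀ x ∈ Sa a, K * signChar (M x) = ∑ α : κ → ZMod 2, ∑ w : κ → ZMod 2,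
        signChar (Φ (Sum.elim a w)) * signChar (∑ i, α i * w i) *
          signChar (∑ i, α i * L i x) := by
      intro x hx
      have hxa : (fun u => p u x) = a := (Finset.mem_filter.1 hx).2
      rw [Finset.sum_comm]
      have hin : ∀ w : κ → ZMod 2, ∑ α : κ → ZMod 2, signChar (Φ (Sum.elim a w)) *
          signChar (∑ i, α i * w i) * signChar (∑ i, α i * L i x) =
          if w = fun i => L i x then signChar (Φ (Sum.elim a w)) * K else 0 := by
        intro w
        rw [← mul_ite_zero, ← sum_signChar_dotProduct (fun i => L i x) w, Finset.mul_sum]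
        refine Finset.sum_congr rfl fun α _ => ?_
        simp_rw [mul_add]
        rw [Finset.sum_add_distrib, signChar_add]
        ring
      rw [Finset.sum_congr rfl fun w _ => hin w, Finset.sum_ite_eq', if_pos (Finset.mem_univ _),
        hM, ← hxa, mul_comm]
    rw [Finset.mul_sum, Finset.sum_congr rfl hpt, Finset.sum_comm]
    refine Finset.sum_congr rfl fun α _ => ?_
    rw [Finset.sum_comm, Finset.sum_mul]
    refine Finset.sum_congr rfl fun w _ => ?_
    rw [Finset.mul_sum]
  have hcell : ∀ a, ∑ x ∈ Sa a, signChar (M x) ≤ (1 - 4 * ε) * (Sa a).card + K * (η * N) := by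
    intro a
    refine le_of_mul_le_mul_left ?_ hK
    rw [hexp a]
    have hα : ∀ α : κ → ZMod 2, (∑ w : κ → ZMod 2, signChar (Φ (Sum.elim a w)) *
        signChar (∑ i, α i * w i)) * ∑ x ∈ Sa a, signChar (∑ i, α i * L i x) ≤
        (if α = 0 then (1 - 4 * ε) * K * (Sa a).card else 0) + K * (η * N) := by
      intro α
      split_ifs with h
      · subst h
        simp only [Pi.zero_apply, zero_mul, Finset.sum_const_zero, signChar_zero, mul_one,
          Finset.sum_const, nsmul_eq_mul]
        have := mul_le_mul_of_nonneg_right (hbias a) (Nat.cast_nonneg (α := ℝ) (Sa a).card)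
        have : 0 ≤ K * (η * N) := by positivity
        linarith
      · rw [zero_add]
        refine (le_abs_self _).trans ?_
        rw [abs_mul]
        refine mul_le_mul ?_ (hcon a α h).le (abs_nonneg _) hK.le
        refine (Finset.abs_sum_le_sum_abs _ _).trans ?_
        simp [abs_mul, abs_signChar, hKdef]
    refine (Finset.sum_le_sum fun α _ => hα α).trans (le_of_eq ?_)
    rw [Finset.sum_add_distrib, Finset.sum_ite_eq', if_pos (Finset.mem_univ _), Finset.sum_const,
      nsmul_eq_mul, Finset.card_univ, ← hKdef]
    ring
  have htotal : ∑ x ∈ S, signChar (M x) ≤ (1 - 4 * ε) * S.card + P * (K * (η * N)) := by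
    rw [← Finset.sum_fiberwise S (fun x u => p u x)]
    refine (Finset.sum_le_sum fun a _ => hcell a).trans (le_of_eq ?_)
    rw [Finset.sum_add_distrib, ← Finset.mul_sum, Finset.sum_const, nsmul_eq_mul, Finset.card_univ,
      ← hPdef]
    congr 2
    rw [← Nat.cast_sum, Finset.card_eq_sum_card_fiberwise fun x _ => Finset.mem_univ fun u => p u x]
  have hsmall : P * (K * (η * N)) = ε * (δ * N) := by
    rw [hη, hε]; field_simp
  rw [sum_signChar_eq, hsmall] at htotal
  have hpos : 0 < δ * N := by positivity
  nlinarith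

end Correlation

/-! ### The uniform bound -/

section Uniform

variable {d : ℕ}

/-- The induction statement for the uniform bound. It concerns forms on `I` which vanish on almost
all of `S` and are polynomial expressions in forms `p u` and forms `L i`, where the
blocks of the forms `L i` are given by `b`. The forms `p u` are fixed, whereas the polynomial and
the forms `L i` may depend on the form on `I`. -/
def UniformRankBoundFor (I : Finset (Fin d)) (κ : Type) [Fintype κ] [DecidableEq κ]
    (b : κ → Finset (Fin d)) : Prop :=
  ∀ (π : Type) [Fintype π] [DecidableEq π] (bπ : π → Finset (Fin d)),
    (∀ u, (bπ u).Nonempty ∧ bπ u ⊆ I) → ∀ δ : ℝ, 0 < δ → ∃ K : ℕ,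
    ∀ (n : Fin d → ℕ) (S : Finset (Tuples n)), δ * Fintype.card (Tuples n) ≤ S.card →
    ∀ p : π → Tuples n → ZMod 2, (∀ u, IsForm (bπ u) (p u)) →
    ∃ Q : Finset (Finset (Fin d) × (Tuples n → ZMod 2)), IsFormFamily I Q ∧ Q.card ≤ K ∧
      ∀ (L : κ → Tuples n → ZMod 2) (Φ : (π ⊕ κ → ZMod 2) → ZMod 2), (∀ i, IsForm (b i) (L i)) →
        IsMultiform (Sum.elim bπ b) I Φ →
        (1 - 1 / 2 ^ (I.card + 1) : ℝ) * S.card ≤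
          ((S.filter fun x => Φ (Sum.elim (fun u => p u x) fun i => L i x) = 0).card : ℝ) →
        (fun x => Φ (Sum.elim (fun u => p u x) fun i => L i x)) ∈ formSpan I Q

/-- The variables that remain after eliminating the variable `j` of block `I₀`: the other
variables, and `R` pairs of variables for every decomposition of `I₀` into two nonempty sets. -/
abbrev ReducedVars (κ : Type) [Fintype κ] [DecidableEq κ] (j : κ) (I₀ : Finset (Fin d)) (R : ℕ) :
    Type :=
  ↥(Finset.univ.erase j) ⊕ (↥(I₀.ssubsets.erase ∅) × Fin R) × Bool

/-- The blocks of the variables in `ReducedVars`. -/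
def reducedBlock {κ : Type} [Fintype κ] [DecidableEq κ] (b : κ → Finset (Fin d)) (j : κ)
    (I₀ : Finset (Fin d)) (R : ℕ) : ReducedVars κ j I₀ R → Finset (Fin d) :=
  Sum.elim (fun i => b i) fun v => if v.2 then I₀ \ v.1.1 else v.1.1

theorem isDershowitzMannaLT_reducedBlock {κ : Type} [Fintype κ] [DecidableEq κ]
    (b : κ → Finset (Fin d)) (j : κ) (R : ℕ) :
    Multiset.IsDershowitzMannaLT
      ((Finset.univ : Finset (ReducedVars κ j (b j) R)).val.map (reducedBlock b j (b j) R))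
      (Finset.univ.val.map b) := by
  refine ⟨(Finset.univ.erase j).val.map b,
    (Finset.univ : Finset ((↥((b j).ssubsets.erase ∅) × Fin R) × Bool)).val.map
      (fun v => if v.2 then b j \ v.1.1 else v.1.1), {b j}, by simp, ?_, ?_, ?_⟩
  · rw [← Finset.univ_disjSum_univ, Finset.val_disjSum, Multiset.disjSum, Multiset.map_add,
      Multiset.map_map, Multiset.map_map]
    congr 1
    rw [Finset.univ_eq_attach, Finset.attach_val]
    exact Multiset.attach_map_val' _ b
  · conv_lhs => rw [← Finset.insert_erase (Finset.mem_univ j)]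
    rw [Finset.insert_val_of_notMem (Finset.notMem_erase _ _), Multiset.map_cons, add_comm]
    rfl
  · intro y hy
    obtain ⟨⟨⟨⟨J, hJ⟩, r⟩, c⟩, -, rfl⟩ := Multiset.mem_map.1 hy
    refine ⟨b j, by simp, ?_⟩
    obtain ⟨hne, hss⟩ := Finset.mem_erase.1 hJ
    rw [Finset.mem_ssubsets] at hss
    cases c
    · simpa using hss
    · simpa using Finset.sdiff_ssubset hss.subset (Finset.nonempty_iff_ne_empty.2 hne)

open scoped BigOperators in
/-- Tuples of forms `L` whose fixed combination `∑ i, α i * L i` correlates with `S` on one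
of the sets where all `p u` are constant have a bounded net with respect
to the bias of the combination. -/
theorem exists_net {π κ : Type} [Fintype π] [DecidableEq π] [Fintype κ] [DecidableEq κ]
    {n : Fin d → ℕ} (b : κ → Finset (Fin d)) (α : κ → ZMod 2) (p : π → Tuples n → ZMod 2)
    (S : Finset (Tuples n)) {η : ℝ} (hη : 0 < η) :
    ∃ T : Finset (κ → Tuples n → ZMod 2), (∀ L ∈ T, ∀ i, IsForm (b i) (L i)) ∧
      T.card ≤ ⌈Fintype.card (π → ZMod 2) * (2 / η ^ 2)⌉₊ ∧
      ∀ L : κ → Tuples n → ZMod 2, (∀ i, IsForm (b i) (L i)) → (∃ a : π → ZMod 2,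
        η * Fintype.card (Tuples n) ≤
          |∑ x ∈ S.filter fun x => (fun u => p u x) = a, signChar (∑ i, α i * L i x)|) →
        ∃ L' ∈ T, η ^ 2 / 2 ≤ |𝔼 x : Tuples n, signChar (∑ i, α i * (L i x + L' i x))| := by
  classical
  have hN : (0 : ℝ) < Fintype.card (Tuples n) := by exact_mod_cast Fintype.card_pos
  set N : ℝ := ((Fintype.card (Tuples n) : ℕ) : ℝ) with hNdef
  set F : (κ → Tuples n → ZMod 2) → Tuples n → ℝ := fun L x => signChar (∑ i, α i * L i x) with hF
  have hFabs : ∀ L x, |F L x| = 1 := fun L x => abs_signChar _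
  have hFF : ∀ L L' x, F L x * F L' x = signChar (∑ i, α i * (L i x + L' i x)) := by
    intro L L' x
    rw [hF, ← signChar_add, ← Finset.sum_add_distrib]
    simp_rw [mul_add]
  set cor : (π → ZMod 2) → (κ → Tuples n → ZMod 2) → Prop := fun a L =>
    η * N ≤ |∑ x ∈ S.filter fun x => (fun u => p u x) = a, F L x| with hcor
  set Λ : Set (κ → Tuples n → ZMod 2) :=
    {L | (∀ i, IsForm (b i) (L i)) ∧ ∃ a : π → ZMod 2, cor a L} with hΛ
  set r : (κ → Tuples n → ZMod 2) → (κ → Tuples n → ZMod 2) → Prop := fun L L' =>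
    η ^ 2 / 2 * N ≤ |∑ x, F L x * F L' x| with hr
  have hη1 : ∀ L ∈ Λ, η ≤ 1 := by
    rintro L ⟨-, a, ha⟩
    refine le_of_mul_le_mul_right (ha.trans ?_) hN
    refine (Finset.abs_sum_le_sum_abs _ _).trans ?_
    simp only [hFabs, Finset.sum_const, nsmul_eq_mul, mul_one, one_mul, hNdef]
    exact_mod_cast Finset.card_le_univ _
  obtain ⟨T, hTΛ, hTcard, hT⟩ := exists_finset_net Λ r (fun L hL => by
      have h1 := hη1 L hL
      have h2 : ∀ x, F L x * F L x = 1 := fun x => by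
        rw [← abs_mul_abs_self, hFabs, one_mul]
      simp only [hr, h2, Finset.sum_const, nsmul_eq_mul, mul_one, Finset.card_univ, ← hNdef,
        abs_of_pos hN]
      have h3 : η ^ 2 / 2 ≤ 1 := by nlinarith
      exact mul_le_of_le_one_left hN.le h3) ⌈Fintype.card (π → ZMod 2) * (2 / η ^ 2)⌉₊ (by
    intro T hT hsep
    rw [← Nat.cast_le (α := ℝ)]
    refine le_trans ?_ (Nat.le_ceil _)
    have hfib : ∀ a : π → ZMod 2, ((T.filter fun L => cor a L).card : ℝ) ≤ 2 / η ^ 2 := by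
      intro a
      refine card_le_of_correlation (F := F) (fun L _ x => hFabs L x)
        (g := fun x => if x ∈ S.filter fun x => (fun u => p u x) = a then 1 else 0)
        (fun x => by split_ifs <;> simp) hη (fun L hL => ?_) fun L hL L' hL' hne => ?_
      · simp_rw [ite_mul, one_mul, zero_mul, Finset.sum_ite_mem, Finset.univ_inter]
        exact (Finset.mem_filter.1 hL).2
      · have := not_le.1 (hsep L (Finset.mem_filter.1 hL).1 L' (Finset.mem_filter.1 hL').1 hne)
        exact ⟨(abs_le.1 this.le).2, (abs_le.1 this.le).1⟩
    have hcover : T.card ≤ ∑ a : π → ZMod 2, (T.filter fun L => cor a L).card := by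
      refine le_trans (Finset.card_le_card fun L hL => ?_) Finset.card_biUnion_le
      obtain ⟨a, ha⟩ := (hT L hL).2
      exact Finset.mem_biUnion.2 ⟨a, Finset.mem_univ _, Finset.mem_filter.2 ⟨hL, ha⟩⟩
    calc (T.card : ℝ) ≤ ((∑ a : π → ZMod 2, (T.filter fun L => cor a L).card : ℕ) : ℝ) := by
          exact_mod_cast hcover
      _ = ∑ a : π → ZMod 2, ((T.filter fun L => cor a L).card : ℝ) := Nat.cast_sum _ _
      _ ≤ ∑ _a : π → ZMod 2, 2 / η ^ 2 := Finset.sum_le_sum fun a _ => hfib a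
      _ = _ := by rw [Finset.sum_const, nsmul_eq_mul, Finset.card_univ])
  refine ⟨T, fun L hL => (hTΛ L hL).1, hTcard, fun L hL hLcor => ?_⟩
  obtain ⟨L', hL', h⟩ := hT L ⟨hL, hLcor⟩
  refine ⟨L', hL', ?_⟩
  have h' : η ^ 2 / 2 * N ≤ |∑ x, F L x * F L' x| := by
    rcases h with h | h
    · exact h
    · refine h.trans_eq ?_
      simp_rw [mul_comm]
  simp_rw [hFF] at h'
  rw [Fintype.expect_eq_sum_div_card, abs_div, ← hNdef, abs_of_pos hN, le_div_iff₀ hN]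
  exact h'

open scoped BigOperators in
/-- If `α j ≠ 0` and `b j` is a largest block among those with nonzero coefficient, then tuples `L`
and `L'` with biased difference of the combinations given by `α` satisfy a relation that
expresses `L j` by the other `L i`, a combination of the `L' i`, and forms on proper subsets of
the block `b j`. -/
theorem exists_relation {κ : Type} [Fintype κ] [DecidableEq κ] {n : Fin d → ℕ}
    {b : κ → Finset (Fin d)} {α : κ → ZMod 2} {j : κ} (hj : α j ≠ 0)
    (hmax : ∀ i, α i ≠ 0 → (b i).card ≤ (b j).card) (hne : (b j).Nonempty) {c : ℝ} (hc : 0 < c)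
    {R : ℕ}
    (hR : ∀ M : Tuples n → ZMod 2, IsForm (b j) M →
      c ^ 2 ^ (b j).card ≤ 𝔼 x : Tuples n, signChar (M x) →
      ∃ g h : Finset (Fin d) → Fin R → Tuples n → ZMod 2,
        (∀ J ∈ (b j).ssubsets.erase ∅, ∀ r, IsForm J (g J r) ∧ IsForm (b j \ J) (h J r)) ∧
        ∀ x, M x = ∑ J ∈ (b j).ssubsets.erase ∅, ∑ r, g J r x * h J r x)
    {L L' : κ → Tuples n → ZMod 2} (hL : ∀ i, IsForm (b i) (L i)) (hL' : ∀ i, IsForm (b i) (L' i))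
    (hbias : c ≤ |𝔼 x : Tuples n, signChar (∑ i, α i * (L i x + L' i x))|) :
    ∃ g h : Finset (Fin d) → Fin R → Tuples n → ZMod 2,
      (∀ J ∈ (b j).ssubsets.erase ∅, ∀ r, IsForm J (g J r) ∧ IsForm (b j \ J) (h J r)) ∧
      ∀ x, L j x = ∑ i ∈ Finset.univ.filter (fun i => b i = b j), α i * L' i x +
        ∑ i ∈ (Finset.univ.erase j).filter (fun i => b i = b j), α i * L i x +
        ∑ J ∈ (b j).ssubsets.erase ∅, ∑ r, g J r x * h J r x := by
  have hD : ∀ i, IsForm (b i) (fun x => α i * (L i x + L' i x)) := fun i =>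
    ((hL i).fun_add (hL' i)).const_mul _
  set φ : Tuples n → ZMod 2 := fun x =>
    ∑ i ∈ Finset.univ.filter (fun i => b i = b j), α i * (L i x + L' i x) with hφ
  have hφform : IsForm (b j) φ := IsMultiform.fun_sum fun i hi => by
    rw [← (Finset.mem_filter.1 hi).2]
    exact hD i
  have hsplit : ∀ x, ∑ i, α i * (L i x + L' i x) = φ x +
      ∑ i ∈ Finset.univ.filter (fun i => b i ≠ b j ∧ α i ≠ 0), α i * (L i x + L' i x) := by
    intro x
    rw [← Finset.sum_filter_add_sum_filter_not Finset.univ (fun i => b i = b j)]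
    congr 1
    refine (Finset.sum_subset (fun i hi => ?_) fun i hi hi' => ?_).symm
    · simp only [Finset.mem_filter, Finset.mem_univ, true_and] at hi ⊢
      exact hi.1
    · simp only [Finset.mem_filter, Finset.mem_univ, true_and, not_and, not_not] at hi hi'
      rw [hi' hi, zero_mul]
  have hweyl := hφform.expect_add_sum_pow_le
    (Finset.univ.filter (fun i => b i ≠ b j ∧ α i ≠ 0)) b
    (fun i x => α i * (L i x + L' i x)) (fun i _ => hD i) fun i hi hsub => by
      obtain ⟨-, hne, hα⟩ := Finset.mem_filter.1 hi
      exact hne (Finset.eq_of_subset_of_card_le hsub (hmax i hα)).symm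
  simp_rw [← hsplit] at hweyl
  obtain ⟨g, h, hgh, hsum⟩ := hR φ hφform (by
    refine le_trans ?_ hweyl
    have heven : Even (2 ^ (b j).card) :=
      (Nat.even_pow' (Finset.card_pos.2 hne).ne').2 even_two
    rw [← heven.pow_abs (𝔼 x : Tuples n, signChar (∑ i, α i * (L i x + L' i x)))]
    exact pow_le_pow_left₀ hc.le hbias _)
  refine ⟨g, h, hgh, fun x => ?_⟩
  rw [← hsum, hφ]
  have hjmem : j ∈ Finset.univ.filter (fun i => b i = b j) := by simp
  have herase : (Finset.univ.filter (fun i => b i = b j)).erase j =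
      (Finset.univ.erase j).filter (fun i => b i = b j) := Finset.filter_erase _ _ _ |>.symm
  simp_rw [mul_add, Finset.sum_add_distrib]
  rw [← Finset.add_sum_erase _ (fun i => α i * L i x) hjmem, herase,
    zmod_two_ne_zero_iff.1 hj, one_mul]
  -- Apart from `L j x`, every term occurs twice.
  generalize ∑ i ∈ Finset.univ.filter (fun i => b i = b j), α i * L' i x = u
  generalize ∑ i ∈ (Finset.univ.erase j).filter (fun i => b i = b j), α i * L i x = v
  linear_combination -zmod_two_add_self u - zmod_two_add_self v

/-- The substitution that eliminates the variable `j`: the variable is replaced by the sum of the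
new parameter with index `r`, a combination of other variables from the same block, and products
of pairs of the new variables. -/
def eliminate {π κ : Type} [Fintype κ] [DecidableEq κ] (b : κ → Finset (Fin d)) (α : κ → ZMod 2)
    (j : κ) (R : ℕ) {N : ℕ} (r : Fin N) :
    π ⊕ κ → ((π ⊕ Fin N) ⊕ ReducedVars κ j (b j) R → ZMod 2) → ZMod 2 :=
  Sum.elim (fun u z => z (Sum.inl (Sum.inl u))) fun i z =>
    if h : i = j then
      z (Sum.inl (Sum.inr r)) +
        ∑ i ∈ Finset.univ.filter (fun i : ↥(Finset.univ.erase j) => b i = b j),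
          α i * z (Sum.inr (Sum.inl i)) +
        ∑ v : ↥((b j).ssubsets.erase ∅) × Fin R,
          z (Sum.inr (Sum.inr (v, false))) * z (Sum.inr (Sum.inr (v, true)))
    else z (Sum.inr (Sum.inl ⟨i, by simp [h]⟩))

theorem isMultiform_eliminate {π κ : Type} [Fintype κ] [DecidableEq κ]
    (bπ : π → Finset (Fin d)) (b : κ → Finset (Fin d)) (α : κ → ZMod 2) (j : κ) (R : ℕ) {N : ℕ}
    (r : Fin N) (i : π ⊕ κ) :
    IsMultiform (Sum.elim (Sum.elim bπ fun _ => b j) (reducedBlock b j (b j) R))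
      (Sum.elim bπ b i) (eliminate b α j R r i) := by
  set B : (π ⊕ Fin N) ⊕ ReducedVars κ j (b j) R → Finset (Fin d) :=
    Sum.elim (Sum.elim bπ fun _ => b j) (reducedBlock b j (b j) R) with hB
  rcases i with u | i
  · exact isMultiform_var (b := B) (Sum.inl (Sum.inl u))
  · by_cases h : i = j
    · subst h
      simp only [eliminate, Sum.elim_inr, dif_pos]
      refine IsMultiform.fun_add (IsMultiform.fun_add
        (isMultiform_var (b := B) (Sum.inl (Sum.inr r))) ?_) ?_
      · refine IsMultiform.fun_sum fun k hk => IsMultiform.const_mul _ ?_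
        convert isMultiform_var (b := B) (Sum.inr (Sum.inl k)) using 1
        exact (Finset.mem_filter.1 hk).2.symm
      · refine IsMultiform.fun_sum fun v _ => ?_
        have hsub : v.1.1 ⊆ b i :=
          (Finset.mem_ssubsets.1 (Finset.mem_erase.1 v.1.2).2).subset
        have h1 := isMultiform_var (b := B) (Sum.inr (Sum.inr (v, false)))
        have h2 := isMultiform_var (b := B) (Sum.inr (Sum.inr (v, true)))
        have e1 : B (Sum.inr (Sum.inr (v, false))) = v.1.1 := by simp [hB, reducedBlock]
        have e2 : B (Sum.inr (Sum.inr (v, true))) = b i \ v.1.1 := by simp [hB, reducedBlock]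
        rw [e1] at h1
        rw [e2] at h2
        have := h1.fun_mul h2 Finset.disjoint_sdiff
        rwa [Finset.union_sdiff_of_subset hsub] at this
    · simp only [eliminate, Sum.elim_inr, dif_neg h]
      exact isMultiform_var (b := B) (Sum.inr (Sum.inl ⟨i, by simp [h]⟩))

/-- The part of the induction step that concerns a fixed nontrivial combination `α` of the
variables. -/
theorem exists_family_of_correlation {I : Finset (Fin d)}
    (hN : ∀ J ⊆ I, J.Nonempty → BiasRankBound J) {κ : Type} [Fintype κ] [DecidableEq κ]
    {b : κ → Finset (Fin d)} (hb : ∀ i, (b i).Nonempty ∧ b i ⊆ I)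
    (ih : ∀ (j : κ) (R : ℕ), UniformRankBoundFor I (ReducedVars κ j (b j) R)
      (reducedBlock b j (b j) R))
    {π : Type} [Fintype π] [DecidableEq π] (bπ : π → Finset (Fin d))
    (hbπ : ∀ u, (bπ u).Nonempty ∧ bπ u ⊆ I) {δ η : ℝ} (hδ : 0 < δ) (hη : 0 < η)
    {α : κ → ZMod 2} (hα : α ≠ 0) :
    ∃ K : ℕ, ∀ (n : Fin d → ℕ) (S : Finset (Tuples n)), δ * Fintype.card (Tuples n) ≤ S.card →
    ∀ p : π → Tuples n → ZMod 2, (∀ u, IsForm (bπ u) (p u)) →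
    ∃ Q : Finset (Finset (Fin d) × (Tuples n → ZMod 2)), IsFormFamily I Q ∧ Q.card ≤ K ∧
      ∀ (L : κ → Tuples n → ZMod 2) (Φ : (π ⊕ κ → ZMod 2) → ZMod 2), (∀ i, IsForm (b i) (L i)) →
        IsMultiform (Sum.elim bπ b) I Φ →
        (1 - 1 / 2 ^ (I.card + 1) : ℝ) * S.card ≤
          ((S.filter fun x => Φ (Sum.elim (fun u => p u x) fun i => L i x) = 0).card : ℝ) →
        (∃ a : π → ZMod 2, η * Fintype.card (Tuples n) ≤
          |∑ x ∈ S.filter fun x => (fun u => p u x) = a, signChar (∑ i, α i * L i x)|) →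
        (fun x => Φ (Sum.elim (fun u => p u x) fun i => L i x)) ∈ formSpan I Q := by
  classical
  obtain ⟨j, hj, hmax⟩ : ∃ j, α j ≠ 0 ∧ ∀ i, α i ≠ 0 → (b i).card ≤ (b j).card := by
    obtain ⟨j₀, hj₀⟩ := Function.ne_iff.1 hα
    obtain ⟨j, hj, hjmax⟩ := Finset.exists_max_image (Finset.univ.filter fun i => α i ≠ 0)
      (fun i => (b i).card) ⟨j₀, by simpa using hj₀⟩
    exact ⟨j, (Finset.mem_filter.1 hj).2, fun i hi => hjmax i (by simpa using hi)⟩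
  have hc : 0 < η ^ 2 / 2 := by positivity
  obtain ⟨R, hR⟩ := hN (b j) (hb j).2 (hb j).1 ((η ^ 2 / 2) ^ 2 ^ (b j).card) (by positivity)
  set N := ⌈(Fintype.card (π → ZMod 2) : ℝ) * (2 / η ^ 2)⌉₊
  obtain ⟨K, hK⟩ := ih j R (π ⊕ Fin N) (Sum.elim bπ fun _ => b j)
    (by rintro (u | u); exacts [hbπ u, hb j]) δ hδ
  refine ⟨K, fun n S hS p hp => ?_⟩
  obtain ⟨T, hTform, hTcard, hT⟩ := exists_net (n := n) b α p S hη
  obtain ⟨e, heT, hTe, -⟩ := exists_fin_option_enum (K := N) T hTcard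
  -- The net, with zero forms as padding, provides the new parameters.
  set C : Fin N → κ → Tuples n → ZMod 2 := fun r => (e r).elim (fun _ _ => 0) id with hC
  have hCform : ∀ r i, IsForm (b i) (C r i) := by
    intro r i
    simp only [hC]
    cases her : e r with
    | none => exact IsMultiform.zero
    | some L => exact hTform L (heT r L her) i
  set q : Fin N → Tuples n → ZMod 2 := fun r x =>
    ∑ i ∈ Finset.univ.filter (fun i => b i = b j), α i * C r i x with hq
  have hqform : ∀ r, IsForm (b j) (q r) := fun r => IsMultiform.fun_sum fun i hi => by
    rw [← (Finset.mem_filter.1 hi).2]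
    exact (hCform r i).const_mul _
  obtain ⟨Q, hQ, hQK, hQM⟩ := hK n S hS (Sum.elim p q) (by rintro (u | r); exacts [hp u, hqform r])
  refine ⟨Q, hQ, hQK, fun L Φ hL hΦ hzero hcor => ?_⟩
  obtain ⟨L', hL'T, hbias⟩ := hT L hL hcor
  obtain ⟨r, hr⟩ := hTe L' hL'T
  obtain ⟨g, h, hgh, hrel⟩ := exists_relation hj hmax (hb j).1 hc (hR n) hL (hTform L' hL'T) hbias
  set L₂ : ReducedVars κ j (b j) R → Tuples n → ZMod 2 := Sum.elim (fun i => L i)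
    fun v => if v.2 then h v.1.1 v.1.2 else g v.1.1 v.1.2 with hL₂
  have hL₂form : ∀ v, IsForm (reducedBlock b j (b j) R v) (L₂ v) := by
    rintro (i | ⟨v, c⟩)
    · exact hL i
    · cases c
      · simpa [hL₂, reducedBlock] using (hgh v.1 v.1.2 v.2).1
      · simpa [hL₂, reducedBlock] using (hgh v.1 v.1.2 v.2).2
  have hval : ∀ x, (fun i => eliminate b α j R r i
      (Sum.elim (fun u => Sum.elim p q u x) fun v => L₂ v x)) =
      Sum.elim (fun u => p u x) fun i => L i x := by
    intro x
    funext i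
    rcases i with u | i
    · rfl
    · by_cases hij : i = j
      · subst hij
        have hCr : C r = L' := by simp [hC, hr]
        simp only [eliminate, Sum.elim_inr, Sum.elim_inl, dif_pos, hL₂, Bool.false_eq_true,
          if_false, if_true]
        have hqr : q r x = ∑ k ∈ Finset.univ.filter (fun k => b k = b i), α k * L' k x := by
          simp only [hq, hCr]
        rw [hrel x, hqr]
        congr 1
        · congr 1
          rw [Finset.sum_filter, Finset.sum_filter]
          exact Finset.sum_coe_sort (Finset.univ.erase i)
            fun k => if b k = b i then α k * L k x else 0
        · rw [Fintype.sum_prod_type]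
          exact Finset.sum_coe_sort ((b i).ssubsets.erase ∅)
            fun J => ∑ r, g J r x * h J r x
      · simp [eliminate, hij, hL₂]
  have hfinal := hQM L₂ (fun z => Φ fun i => eliminate b α j R r i z) hL₂form
    (hΦ.comp (isMultiform_eliminate bπ b α j R r))
  simp_rw [hval] at hfinal
  exact hfinal hzero

/-- Induction on the multiset of the blocks of the variables, in the Dershowitz–Manna order. -/
theorem uniformRankBoundFor {I : Finset (Fin d)} (hN : ∀ J ⊆ I, J.Nonempty → BiasRankBound J) :
    ∀ (s : Multiset (Finset (Fin d))) (κ : Type) [Fintype κ] [DecidableEq κ]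
      (b : κ → Finset (Fin d)), (∀ i, (b i).Nonempty ∧ b i ⊆ I) → Finset.univ.val.map b = s →
      UniformRankBoundFor I κ b := by
  classical
  intro s
  have hwf := Multiset.wellFounded_isDershowitzMannaLT (α := Finset (Fin d))
  induction s using hwf.induction with
  | _ s ih =>
    rintro κ _ _ b hb rfl π _ _ bπ hbπ δ hδ
    have ih' : ∀ (j : κ) (R : ℕ), UniformRankBoundFor I (ReducedVars κ j (b j) R)
        (reducedBlock b j (b j) R) := by
      refine fun j R => ih _ (isDershowitzMannaLT_reducedBlock b j R) _ _ ?_ rfl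
      rintro (i | ⟨⟨⟨J, hJ⟩, r⟩, c⟩)
      · exact hb i
      · obtain ⟨hne, hss⟩ := Finset.mem_erase.1 hJ
        rw [Finset.mem_ssubsets] at hss
        cases c
        · exact ⟨by simpa [reducedBlock] using Finset.nonempty_iff_ne_empty.2 hne,
            by simpa [reducedBlock] using hss.subset.trans (hb j).2⟩
        · exact ⟨by simpa [reducedBlock] using Finset.sdiff_nonempty.2 hss.not_subset,
            by simpa [reducedBlock] using Finset.sdiff_subset.trans (hb j).2⟩
    set η := δ / 2 ^ (I.card + 1) / (Fintype.card (π → ZMod 2) * Fintype.card (κ → ZMod 2) : ℝ)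
      with hηdef
    have hη : 0 < η := by positivity
    choose K hK using fun α : {α : κ → ZMod 2 // α ≠ 0} =>
      exists_family_of_correlation hN hb ih' bπ hbπ hδ hη α.2
    refine ⟨Fintype.card π + ∑ α, K α, fun n S hS p hp => ?_⟩
    choose Q hQ hQK hQM using fun α => hK α n S hS p hp
    set Qp : Finset (Finset (Fin d) × (Tuples n → ZMod 2)) :=
      Finset.univ.image fun u => (bπ u, p u) with hQp
    refine ⟨Qp ∪ Finset.univ.biUnion Q, fun q hq => ?_, ?_, fun L Φ hL hΦ hzero => ?_⟩
    · rcases Finset.mem_union.1 hq with hq | hq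
      · obtain ⟨u, -, rfl⟩ := Finset.mem_image.1 hq
        exact ⟨(hbπ u).1, (hbπ u).2, hp u⟩
      · obtain ⟨α, -, hq⟩ := Finset.mem_biUnion.1 hq
        exact hQ α q hq
    · refine (Finset.card_union_le _ _).trans (add_le_add Finset.card_image_le ?_)
      exact Finset.card_biUnion_le.trans (Finset.sum_le_sum fun α _ => hQK α)
    · have hB : ∀ i, (Sum.elim bπ b i).Nonempty ∧ Sum.elim bπ b i ⊆ I := by
        rintro (u | i)
        exacts [hbπ u, hb i]
      by_cases h0 : ∀ w : κ → ZMod 2, Φ (Sum.elim 0 w) = 0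
      · have hmem := hΦ.mem_formSpan (fun i => (hB i).2) (f := Sum.elim p L)
          (by rintro (u | i); exacts [hp u, hL i]) h0 (Q := Qp)
          (fun u => Finset.mem_image_of_mem _ (Finset.mem_univ u))
        refine formSpan_mono Finset.subset_union_left ?_
        convert hmem using 3 with x
        funext i
        rcases i with u | i <;> rfl
      · push Not at h0
        obtain ⟨w₀, hw₀⟩ := h0
        obtain ⟨a, α, hα, hcor⟩ := hΦ.exists_correlation (fun i => (hB i).1) hw₀ p L hδ hS hzero
        refine formSpan_mono ?_ (hQM ⟨α, hα⟩ L Φ hL hΦ hzero ⟨a, hcor⟩)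
        exact (Finset.subset_biUnion_of_mem Q (Finset.mem_univ _)).trans Finset.subset_union_right

theorem uniformRankBound (I : Finset (Fin d)) : UniformRankBound I := by
  induction I using Finset.strongInduction with
  | H I ih =>
    rcases I.eq_empty_or_nonempty with rfl | hI
    · exact uniformRankBound_empty
    have hN : ∀ J ⊆ I, J.Nonempty → BiasRankBound J := by
      rintro J hJ ⟨t, ht⟩
      exact (ih _ ((Finset.erase_ssubset ht).trans_subset hJ)).biasRankBound ht
    intro δ hδ
    -- Initially the form itself is the only variable.
    obtain ⟨K, hK⟩ := uniformRankBoundFor hN _ Unit (fun _ => I) (fun _ => ⟨hI, subset_rfl⟩) rfl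
      Empty (fun _ => I) (fun u => u.elim) δ hδ
    refine ⟨K, fun n S hS => ?_⟩
    obtain ⟨Q, hQ, hQK, hQM⟩ := hK n S hS (fun u => u.elim) (fun u => u.elim)
    refine ⟨Q, hQ, hQK, fun M hM hzero => ?_⟩
    refine hQM (fun _ => M) (fun z => z (Sum.inr ())) (fun _ => hM) ?_ hzero
    exact isMultiform_var (b := Sum.elim (fun _ : Empty => I) fun _ : Unit => I) (Sum.inr ())

end Uniform

/-! ### Closed sets and cosets of a subspace -/

section Closed

open Module

variable {G : Type*} [AddCommGroup G] [Module (ZMod 2) G] [Fintype G]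

theorem sum_dual_signChar [DecidableEq G] [Fintype (Dual (ZMod 2) G)] (g : G) :
    ∑ M : Dual (ZMod 2) G, signChar (M g) =
      if g = 0 then (Fintype.card (Dual (ZMod 2) G) : ℝ) else 0 := by
  split_ifs with h
  · simp [h]
  · let f : Dual (ZMod 2) G →+ ZMod 2 := AddMonoidHom.mk' (fun M => M g) fun _ _ => rfl
    refine sum_signChar_addMonoidHom f fun hf => h ?_
    exact (forall_dual_apply_eq_zero_iff (ZMod 2) g).1 fun M => DFunLike.congr_fun hf M

/-- Suppose that translation by `v u`, for `u` in `S`, maps `A` to itself up to a small proportion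
on average, and that every functional which vanishes at almost all `v u` vanishes on `V`. Then
the Fourier transform of `A` is concentrated on the annihilator of `V`, and hence
`A` nearly contains a coset of `V`. -/
theorem exists_coset_of_closed [DecidableEq G] {ι : Type*} {S : Finset ι} (hS : S.Nonempty)
    (v : ι → G) {A : Finset G} (hA : A.Nonempty) {c θ : ℝ} (hc : 0 < c)
    (hclosed : (1 - 2 * c * θ) * A.card * S.card ≤
      ∑ u ∈ S, ((A.filter fun a => a + v u ∈ A).card : ℝ))
    (V : Submodule (ZMod 2) G)
    (hV : ∀ M : Dual (ZMod 2) G,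
      (1 - c) * S.card ≤ ((S.filter fun u => M (v u) = 0).card : ℝ) → ∀ w ∈ V, M w = 0) :
    ∃ a, (1 - θ) * Nat.card V ≤ (Nat.card {w : V // a + (w : G) ∈ A} : ℝ) := by
  classical
  have : Finite (Dual (ZMod 2) G) := DFunLike.finite _
  let _ : Fintype (Dual (ZMod 2) G) := Fintype.ofFinite _
  have hD : (0 : ℝ) < Fintype.card (Dual (ZMod 2) G) := by exact_mod_cast Fintype.card_pos
  set D : ℝ := ((Fintype.card (Dual (ZMod 2) G) : ℕ) : ℝ) with hDdef
  have hS0 : (0 : ℝ) < S.card := by exact_mod_cast hS.card_pos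
  set f : G → ℝ := fun g => ((A.filter fun a => a + g ∈ A).card : ℝ) with hf
  set F : Dual (ZMod 2) G → ℝ := fun M => ∑ a ∈ A, signChar (M a) with hF
  have hinv : ∀ g, ∑ M, F M ^ 2 * signChar (M g) = D * f g := by
    intro g
    have h1 : ∀ M : Dual (ZMod 2) G, F M ^ 2 * signChar (M g) =
        ∑ a ∈ A, ∑ a' ∈ A, signChar (M (a + a' + g)) := by
      intro M
      rw [hF, sq, Finset.sum_mul_sum, Finset.sum_mul]
      refine Finset.sum_congr rfl fun a _ => ?_
      rw [Finset.sum_mul]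
      refine Finset.sum_congr rfl fun a' _ => ?_
      rw [map_add, map_add, signChar_add, signChar_add]
    have h2 : ∀ a ∈ A, ∑ a' ∈ A, ∑ M : Dual (ZMod 2) G, signChar (M (a + a' + g)) =
        if a + g ∈ A then D else 0 := by
      intro a _
      have h3 : ∀ a', a + a' + g = 0 ↔ a + g = a' := by
        intro a'
        have hneg : -a' = a' := by
          have : (2 : ZMod 2) • a' = a' + a' := two_smul _ _
          rw [show (2 : ZMod 2) = 0 from rfl, zero_smul] at this
          exact neg_eq_of_add_eq_zero_left this.symm
        rw [add_right_comm, add_eq_zero_iff_eq_neg, hneg]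
      simp_rw [sum_dual_signChar, h3]
      rw [Finset.sum_ite_eq]
    simp_rw [h1]
    rw [Finset.sum_comm]
    simp_rw [fun a => Finset.sum_comm (s := (Finset.univ : Finset (Dual (ZMod 2) G))) (t := A)
      (f := fun M a' => signChar (M (a + a' + g)))]
    rw [Finset.sum_congr rfl h2, ← Finset.sum_filter, Finset.sum_const, nsmul_eq_mul, mul_comm]
  have hpars : ∑ M, F M ^ 2 = D * A.card := by
    have h0 := hinv 0
    have hf0 : f 0 = A.card := by simp [hf]
    rw [hf0] at h0
    simpa using h0
  set P : Dual (ZMod 2) G → Prop := fun M => ∀ w ∈ V, M w = 0 with hP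
  -- Functionals outside the annihilator of `V` are far from constant on `S`.
  have hoff : ∑ M with ¬ P M, F M ^ 2 ≤ θ * (D * A.card) := by
    have h1 : ∑ M, F M ^ 2 * ∑ u ∈ S, signChar (M (v u)) = D * ∑ u ∈ S, f (v u) := by
      simp_rw [Finset.mul_sum]
      rw [Finset.sum_comm]
      exact Finset.sum_congr rfl fun u _ => hinv (v u)
    have h2 : ∀ M, F M ^ 2 * ∑ u ∈ S, signChar (M (v u)) ≤
        F M ^ 2 * S.card - if ¬ P M then F M ^ 2 * (2 * c * S.card) else 0 := by
      intro M
      rw [sum_signChar_eq]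
      have hle : ((S.filter fun u => M (v u) = 0).card : ℝ) ≤ S.card := by
        exact_mod_cast Finset.card_filter_le _ _
      split_ifs with hM
      · rw [sub_zero]
        exact mul_le_mul_of_nonneg_left (by linarith) (sq_nonneg _)
      · rw [← mul_sub]
        refine mul_le_mul_of_nonneg_left ?_ (sq_nonneg _)
        have := not_le.1 fun h => hM (hV M h)
        linarith
    have h3 := Finset.sum_le_sum fun M (_ : M ∈ Finset.univ) => h2 M
    rw [h1, Finset.sum_sub_distrib, ← Finset.sum_mul, hpars, ← Finset.sum_filter,
      ← Finset.sum_mul] at h3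
    have h4 := mul_le_mul_of_nonneg_left hclosed hD.le
    have h5 : (∑ M with ¬ P M, F M ^ 2) * (2 * c * S.card) ≤
        θ * (D * A.card) * (2 * c * S.card) := by
      linarith
    exact le_of_mul_le_mul_right h5 (by positivity)
  have hon : (1 - θ) * (D * A.card) ≤ ∑ M with P M, F M ^ 2 := by
    have := Finset.sum_filter_add_sum_filter_not Finset.univ P fun M => F M ^ 2
    rw [hpars] at this
    linarith
  have hVsum : (1 - θ) * Fintype.card V * A.card ≤ ∑ w : V, f w := by
    refine le_of_mul_le_mul_left ?_ hD
    have h1 : D * ∑ w : V, f w = ∑ M, F M ^ 2 * ∑ w : V, signChar (M w) := by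
      simp_rw [Finset.mul_sum]
      rw [Finset.sum_comm]
      exact Finset.sum_congr rfl fun w _ => (hinv w).symm
    have h2 : ∀ M : Dual (ZMod 2) G, ∑ w : V, signChar (M w) =
        if P M then (Fintype.card V : ℝ) else 0 := by
      intro M
      split_ifs with hM
      · simp [fun w : V => hM w w.2]
      · let φ : V →+ ZMod 2 := AddMonoidHom.mk' (fun w => M w) fun w w' => by simp
        exact sum_signChar_addMonoidHom φ fun hφ =>
          hM fun w hw => DFunLike.congr_fun hφ (⟨w, hw⟩ : V)
    rw [h1]
    simp_rw [h2, mul_ite, mul_zero]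
    rw [← Finset.sum_filter, ← Finset.sum_mul]
    have := mul_le_mul_of_nonneg_right hon (Nat.cast_nonneg (α := ℝ) (Fintype.card V))
    linarith
  have hswap : ∑ w : V, f w = ∑ a ∈ A, (Nat.card {w : V // a + (w : G) ∈ A} : ℝ) := by
    simp_rw [hf, Nat.card_eq_fintype_card, Fintype.card_subtype, ← Finset.sum_boole]
    rw [Finset.sum_comm]
  rw [hswap] at hVsum
  obtain ⟨a, -, ha⟩ := Finset.exists_le_of_sum_le hA
    (f := fun _ => (1 - θ) * (Fintype.card V : ℝ))
    (g := fun a => (Nat.card {w : V // a + (w : G) ∈ A} : ℝ)) (by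
      rw [Finset.sum_const, nsmul_eq_mul, mul_comm]
      exact hVsum)
  exact ⟨a, by rwa [Nat.card_eq_fintype_card]⟩

end Closed

/-! ### Multilinear forms and functionals on tensor spaces -/

section Tensor

variable {d : ℕ} {n : Fin d → ℕ}

theorem isForm_comp_tprod (M : Module.Dual (ZMod 2) (FullTensor n)) :
    IsForm Finset.univ fun u : Tuples n => M (PiTensorProduct.tprod (ZMod 2) u) :=
  isForm_iff.2 ⟨fun t ht => absurd (Finset.mem_univ t) ht, fun t _ x u v => by
    rw [MultilinearMap.map_update_add, map_add]⟩

open Classical in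
/-- A form on `I` is given by a functional on `𝔽₂^I`. -/
theorem IsMultiform.exists_partialTensor {I : Finset (Fin d)} {φ : Tuples n → ZMod 2}
    (hφ : IsForm I φ) {J : Set (Fin d)} (hJ : ∀ i, i ∈ J ↔ i ∈ I) :
    ∃ ψ : PartialTensor n J →ₗ[ZMod 2] ZMod 2, ∀ u : Tuples n,
      ψ (PiTensorProduct.tprod (ZMod 2) fun i : J => u i) = φ u := by
  let ext : ((i : J) → Fin (n i) → ZMod 2) → Tuples n :=
    fun x i => if h : i ∈ J then x ⟨i, h⟩ else 0
  have hext : ∀ [DecidableEq J] (x : (i : J) → Fin (n i) → ZMod 2) (t : J) (u),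
      ext (Function.update x t u) = Function.update (ext x) t u := by
    intro _ x t u
    funext i
    by_cases hi : i ∈ J
    · by_cases hit : i = t
      · subst hit
        simp [ext]
      · have : (⟨i, hi⟩ : J) ≠ t := fun h => hit (congrArg Subtype.val h)
        simp [ext, hi, hit, this]
    · have : i ≠ t := fun h => hi (h ▸ t.2)
      simp [ext, hi, this]
  have hadd : ∀ [DecidableEq J] (x : (i : J) → Fin (n i) → ZMod 2) (t : J) (u v),
      φ (ext (Function.update x t (u + v))) =
        φ (ext (Function.update x t u)) + φ (ext (Function.update x t v)) := by
    intro _ x t u v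
    rw [hext, hext, hext]
    exact hφ.update_add ((hJ t).1 t.2) _ _ _
  let m : MultilinearMap (ZMod 2) (fun i : J => Fin (n i) → ZMod 2) (ZMod 2) :=
    { toFun := fun x => φ (ext x)
      map_update_add' := fun x t u v => hadd x t u v
      map_update_smul' := fun x t c u => by
        by_cases hc : c = 0
        · subst hc
          rw [zero_smul, zero_smul]
          simpa using hadd x t 0 0
        · rw [zmod_two_ne_zero_iff.1 hc, one_smul, one_smul] }
  refine ⟨PiTensorProduct.lift m, fun u => ?_⟩
  rw [PiTensorProduct.lift.tprod]
  refine hφ.congr_of_subset fun i hi => ?_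
  have : i ∈ J := (hJ i).2 (by simpa using hi)
  simp [ext, this]

/-- A product of functionals on `𝔽₂^I` and `𝔽₂^{Iᶜ}`, as a functional on the whole tensor space. -/
noncomputable def splitMul (I : Set (Fin d)) (ψ : PartialTensor n I →ₗ[ZMod 2] ZMod 2)
    (ψ' : PartialTensor n Iᶜ →ₗ[ZMod 2] ZMod 2) : Module.Dual (ZMod 2) (FullTensor n) :=
  (TensorProduct.lid (ZMod 2) (ZMod 2)).toLinearMap ∘ₗ TensorProduct.map ψ ψ' ∘ₗ
    (splitEquiv n I).symm.toLinearMap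

theorem splitMul_tprod (I : Set (Fin d)) (ψ : PartialTensor n I →ₗ[ZMod 2] ZMod 2)
    (ψ' : PartialTensor n Iᶜ →ₗ[ZMod 2] ZMod 2) (u : Tuples n) :
    splitMul I ψ ψ' (PiTensorProduct.tprod (ZMod 2) u) =
      ψ (PiTensorProduct.tprod (ZMod 2) fun i : I => u i) *
        ψ' (PiTensorProduct.tprod (ZMod 2) fun i : (Iᶜ : Set (Fin d)) => u i) := by
  rw [splitMul, ← splitEquiv_tprod n I u]
  simp

theorem splitMul_eq_zero {I : Set (Fin d)} {ψ : PartialTensor n I →ₗ[ZMod 2] ZMod 2}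
    (ψ' : PartialTensor n Iᶜ →ₗ[ZMod 2] ZMod 2) {H : Submodule (ZMod 2) (PartialTensor n I)}
    (hH : H ≤ LinearMap.ker ψ) {y : FullTensor n} (hy : y ∈ tensorFull n I H) :
    splitMul I ψ ψ' y = 0 := by
  obtain ⟨z, ⟨z', rfl⟩, rfl⟩ := hy
  have h0 : ψ ∘ₗ H.subtype = 0 := by
    ext w
    exact hH w.2
  have h1 : TensorProduct.map ψ ψ' (H.subtype.rTensor (PartialTensor n Iᶜ) z') = 0 := by
    rw [LinearMap.rTensor, ← LinearMap.comp_apply, ← TensorProduct.map_comp, h0,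
      TensorProduct.map_zero_left, LinearMap.zero_apply]
  simp [splitMul, h1]

/-- The common zeros of the functionals belonging to a family of forms form a subspace as in the
definition of simple sets, on which the span of the family vanishes. -/
theorem exists_subspaces_of_family {Q : Finset (Finset (Fin d) × (Tuples n → ZMod 2))}
    (hQ : IsFormFamily Finset.univ Q) :
    ∃ H : (I : Set (Fin d)) → Submodule (ZMod 2) (PartialTensor n I),
      (∀ I, Module.finrank (ZMod 2) (PartialTensor n I ⧸ H I) ≤ Q.card) ∧
      ∀ M : Module.Dual (ZMod 2) (FullTensor n),
        (fun u => M (PiTensorProduct.tprod (ZMod 2) u)) ∈ formSpan Finset.univ Q →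
        ∀ y ∈ (⨅ (I : Set (Fin d)) (_ : I.Nonempty), tensorFull n I (H I) :
          Submodule (ZMod 2) (FullTensor n)), M y = 0 := by
  classical
  have hex : ∀ (I : Set (Fin d)) (q : Finset (Fin d) × (Tuples n → ZMod 2)),
      ∃ ψ : PartialTensor n I →ₗ[ZMod 2] ZMod 2, q ∈ Q → (q.1 : Set (Fin d)) = I →
        ∀ u : Tuples n, ψ (PiTensorProduct.tprod (ZMod 2) fun i : I => u i) = q.2 u := by
    intro I q
    by_cases hq : q ∈ Q ∧ (q.1 : Set (Fin d)) = I
    · obtain ⟨ψ, hψ⟩ := (hQ q hq.1).2.2.exists_partialTensor (J := I) fun i => by simp [← hq.2]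
      exact ⟨ψ, fun _ _ => hψ⟩
    · exact ⟨0, fun h h' => absurd ⟨h, h'⟩ hq⟩
  choose ψ hψ using hex
  refine ⟨fun I => LinearMap.ker (LinearMap.pi fun q : Q => ψ I q), fun I => ?_,
    fun M hM y hy => ?_⟩
  · rw [(LinearMap.quotKerEquivRange (LinearMap.pi fun q : Q => ψ I q)).finrank_eq]
    refine (Submodule.finrank_le _).trans ?_
    simp
  · obtain ⟨h, hh, hsum⟩ := exists_eq_sum_of_mem_formSpan hM
    choose ψ' hψ' using fun q : Finset (Fin d) × (Tuples n → ZMod 2) =>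
      (hh q).exists_partialTensor (J := (q.1 : Set (Fin d))ᶜ) fun i => by simp
    have hMeq : M = ∑ q ∈ Q, splitMul (q.1 : Set (Fin d)) (ψ _ q) (ψ' q) := by
      refine PiTensorProduct.ext (MultilinearMap.ext fun u => ?_)
      simp only [LinearMap.compMultilinearMap_apply, LinearMap.sum_apply]
      rw [hsum u]
      refine Finset.sum_congr rfl fun q hq => ?_
      rw [splitMul_tprod, hψ _ q hq rfl, hψ']
    rw [hMeq, LinearMap.sum_apply]
    refine Finset.sum_eq_zero fun q hq => ?_
    have hyq := (Submodule.mem_iInf _).1 ((Submodule.mem_iInf _).1 hy (q.1 : Set (Fin d)))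
      (by simpa using (hQ q hq).1)
    refine splitMul_eq_zero (ψ' q) (fun w hw => ?_) hyq
    exact congrFun (LinearMap.mem_ker.1 hw) ⟨q, hq⟩

theorem exists_le_map_eq {α β : Type*} {f : α → β} {s : Multiset α} {t : Multiset β}
    (h : t ≤ s.map f) : ∃ u ≤ s, u.map f = t := by
  induction s using Quotient.inductionOn with
  | _ l =>
    induction t using Quotient.inductionOn with
    | _ l' =>
      obtain ⟨l₁, hperm, hsub⟩ := h
      obtain ⟨l₂, hl₂, rfl⟩ := List.sublist_map_iff.1 hsub
      exact ⟨l₂, hl₂.subperm, Quotient.sound hperm⟩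

end Tensor

theorem theorem2p5 (d : ℕ) (hd : 1 ≤ d) :
    ∃ (ε : ℝ → ℝ) (k : ℝ → ℕ),
      (∀ θ : ℝ, 0 < θ → 0 < ε θ) ∧ (∀ δ : ℝ, 0 < δ → 0 < k δ) ∧
      ∀ (θ δ : ℝ), 0 < θ → 0 < δ →
        ∀ (n : Fin d → ℕ) (B' : Multiset (FullTensor n)), B' ≤ rankOneTensors n →
          δ * ((rankOneTensors n).card : ℝ) ≤ (B'.card : ℝ) →
          ∀ A : Set (FullTensor n), A.Nonempty → IsMultisetClosed A B' (1 - ε θ) →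
            ∃ D : Set (FullTensor n), IsSimpleSet n (k δ) D ∧
              (1 - θ) * (D.ncard : ℝ) ≤ ((D ∩ A).ncard : ℝ) := by
  classical
  have hbound : ∀ δ : ℝ, ∃ K : ℕ, 0 < δ → ∀ (n : Fin d → ℕ) (S : Finset (Tuples n)),
      δ * Fintype.card (Tuples n) ≤ S.card →
      ∃ Q : Finset (Finset (Fin d) × (Tuples n → ZMod 2)), IsFormFamily Finset.univ Q ∧
        Q.card ≤ K ∧ ∀ M : Tuples n → ZMod 2, IsForm Finset.univ M →
          (1 - 1 / 2 ^ (d + 1) : ℝ) * S.card ≤ ((S.filter fun x => M x = 0).card : ℝ) →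
          M ∈ formSpan Finset.univ Q := by
    intro δ
    by_cases hδ : 0 < δ
    · obtain ⟨K, hK⟩ := uniformRankBound (Finset.univ : Finset (Fin d)) δ hδ
      rw [Finset.card_univ, Fintype.card_fin] at hK
      exact ⟨K, fun _ => hK⟩
    · exact ⟨0, fun h => absurd h hδ⟩
  choose K hK using hbound
  refine ⟨fun θ => 2 * (1 / 2 ^ (d + 1)) * θ, fun δ => K δ + 1, fun θ hθ => by positivity,
    fun δ _ => Nat.succ_pos _, fun θ δ hθ hδ n B' hB' hcard A hA hclosed => ?_⟩
  obtain ⟨s, hs, rfl⟩ := exists_le_map_eq hB'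
  obtain ⟨S, rfl⟩ : ∃ S : Finset (Tuples n), S.val = s :=
    ⟨⟨s, Multiset.nodup_of_le hs Finset.univ.nodup⟩, rfl⟩
  have hS : δ * Fintype.card (Tuples n) ≤ S.card := by
    simpa [rankOneTensors] using hcard
  have hSne : S.Nonempty := by
    rw [← Finset.card_pos]
    have : (0 : ℝ) < S.card :=
      lt_of_lt_of_le (mul_pos hδ (by exact_mod_cast Fintype.card_pos)) hS
    exact_mod_cast this
  obtain ⟨Q, hQ, hQK, hQM⟩ := hK δ hδ n S hS
  obtain ⟨H, hHcodim, hHM⟩ := exists_subspaces_of_family hQ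
  set V : Submodule (ZMod 2) (FullTensor n) :=
    ⨅ (I : Set (Fin d)) (_ : I.Nonempty), tensorFull n I (H I) with hVdef
  let _ : Fintype (FullTensor n) := Fintype.ofFinite _
  obtain ⟨A, rfl⟩ : ∃ A' : Finset (FullTensor n), (A' : Set (FullTensor n)) = A :=
    ⟨A.toFinset, Set.coe_toFinset A⟩
  obtain ⟨a, ha⟩ := exists_coset_of_closed hSne (fun u => PiTensorProduct.tprod (ZMod 2) u)
    (A := A) (by simpa using hA) (c := 1 / 2 ^ (d + 1)) (θ := θ) (by positivity) (by
      have := hclosed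
      unfold IsMultisetClosed at this
      rw [Set.ncard_coe_finset, Multiset.card_map, Multiset.map_map] at this
      refine this.trans (le_of_eq ?_)
      rw [← Nat.cast_sum]
      congr 1
      refine Finset.sum_congr rfl fun u _ => ?_
      rw [Function.comp_apply, ← Set.ncard_coe_finset, Finset.coe_filter]
      rfl) V fun M hM => hHM M (hQM _ (isForm_comp_tprod M) hM)
  refine ⟨(fun y => a + y) '' (V : Set (FullTensor n)),
    ⟨H, fun I _ => (hHcodim I).trans (hQK.trans (Nat.le_succ _)), a, rfl⟩, ?_⟩
  have hinj : Function.Injective fun y : FullTensor n => a + y := add_right_injective a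
  have hinter : (fun y => a + y) '' (V : Set (FullTensor n)) ∩ (A : Set (FullTensor n)) =
      (fun w : {w : V // a + (w : FullTensor n) ∈ A} => a + (w : FullTensor n)) '' Set.univ := by
    ext x
    constructor
    · rintro ⟨⟨w, hw, rfl⟩, hx⟩
      exact ⟨⟨⟨w, hw⟩, hx⟩, trivial, rfl⟩
    · rintro ⟨⟨⟨w, hw⟩, hx⟩, -, rfl⟩
      exact ⟨⟨w, hw, rfl⟩, hx⟩
  rw [hinter, Set.ncard_image_of_injective _ hinj, Set.ncard_image_of_injective, Set.ncard_univ]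
  · exact ha
  · intro w w' h
    exact Subtype.ext (Subtype.ext (hinj h))
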